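/- **Setting.** Let $A$ be an affine space over a real vector space $L$, with a symplectic potential $\theta:A\times L\to\mathbb{R}$, linear in the second argument, and a bilinear form $[\cdot,\cdot]:L\times L\to\mathbb{R}$ with $\theta(\eta+\xi,\tau)=\theta(\eta,\tau)+[\xi,\tau]$. Put $\omega(\xi,\tau)=\frac12[\xi,\tau]-\frac12[\tau,\xi]$, assumed non-degenerate, $M=\{\tau\in L:[\xi,\tau]=0\ \forall\xi\in L\}$ and $N=\{\tau\in L:[\tau,\xi]=0\ \forall \xi\in L\}$. Assume $L=M+N$ and $\theta(\eta,\tau)=0$ for $\eta\in A$, $\tau\in M$. Let $J:L\to L$ be linear with $J^2=-\mathrm{id}$ and $\omega(J\cdot,J\cdot)=\omega$, such that $g(\tau,\xi)=2\omega(\tau,J\xi)$ makes $L$ a real separable Hilbert space (possibly infinite-dimensional) on which $[\cdot,\cdot]$ is continuous; $A$ carries the induced topology. Put $\{\tau,\xi\}=g(\tau,\xi)+2\mathrm{i}\,\omega(\tau,\xi)$. Let $q:L\to Q=L/M$ be the quotient map, $Q$ with the quotient norm, $j:Q\to L$ the linear section of $q$ with $j(Q)\subseteq JM$, and $\Omega(\phi,\phi')=g(j\phi,j\phi')-\mathrm{i}[j\phi,\phi']$.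 For a space $E$, let $\hat E$ be the algebraic dual of the topological dual of $E$, with the $\sigma$-algebra generated by the evaluations $\hat\phi\mapsto\hat\phi(l)$; $E$ maps canonically to $\hat E$, and continuous linear functionals on $E$ extend canonically to $\hat E$. Let $\nu_Q$ on $\hat Q$ and $\nu_L$ on $\hat L$ be the centered Gaussian measures under which the evaluation at $l$ has variance $\frac12\|l\|^2$, respectively $\|l\|^2$. *Holomorphic representation.* Let $\mathrm{H}^2(\hat L,\nu_L)\subseteq \mathrm{L}^2(\hat L,\nu_L)$ be the closure of the space of square-integrable holomorphic cylinder functions (entire functions of finitely many $\{\tau_i,\cdot\}$). For $f\in\mathrm{H}^2(\hat L,\nu_L)$ its restriction to $L$ is $f|_L(\xi)=\int\overline{\exp(\frac12\{\xi,\cdot\})}\,f\,\mathrm{d}\nu_L$. Put $$\alpha^\eta(\zeta)=\exp\left(\tfrac{\mathrm i}2\theta(\eta,\zeta-\eta)+\tfrac{\mathrm i}2\theta(\zeta,\zeta-\eta)-\tfrac14g(\zeta-\eta,\zeta-\eta)\right).$$ $\mathcal{H}^{\hat H}$ consists of the wave functions $\psi(\zeta)=f|_L(\zeta-\eta)\,\alpha^\eta(\zeta)$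 on $A$, with $\eta\in A$, $f\in\mathrm{H}^2(\hat L,\nu_L)$, and norm $\|f\|$. The affine coherent state of $\zeta\in A$ has the wave function $\hat K^{H}_\zeta=\alpha^\zeta$. *Schrödinger representation.* Given a base point $\eta\in A$, the states of $\mathcal{H}^{\tilde S}$ are presented by $\eta$-reduced wave functions in $\mathrm{L}^2(\hat Q,\nu_Q)$. The $\eta$-reduced wave function of the coherent state of $\zeta\in A$ is, with $d=\eta-\zeta$, $$\hat K^{S,\eta}_\zeta(\phi)=\exp\left(\mathrm i\,\theta(\zeta,d)-\tfrac12\Omega(q(d),q(d))-\mathrm i[d,\phi]-\Omega(q(d),\phi)\right).$$ The presentations $\psi^{S,\eta},\psi^{S,\eta'}$ of a state are related by $\psi^{S,\eta'}(\phi)=\psi^{S,\eta}(\phi+q(\eta'-\eta))\,\hat K^{S,\eta'}_\eta(\phi)$. *Observables.* For a continuous affine $F:A\to\mathbb{R}$ with linear part $F_{\mathrm{lin}}$ let $X_F\in L$ be given by $2\omega(\xi,X_F)=F_{\mathrm{lin}}(\xi)$ for all $\xi\in L$. With $D$ denoting directional derivatives, put $$(\check F\psi)(\zeta)=(F(\zeta)-\theta(\zeta,X_F))\,\psi(\zeta)-\mathrm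 i\,(D_{X_F}\psi)(\zeta)$$ for functions on $A$, and $$(\check F\psi)(\phi)=(F(\eta)-[X_F,\phi]+\mathrm i\,\Omega(q(X_F),\phi))\,\psi(\phi)-\mathrm i\,(D_{q(X_F)}\psi)(\phi)$$ for $\eta$-reduced wave functions on $\hat Q$. Let $\mathcal{H}^{\hat H,cp}$ and $\mathcal{H}^{\tilde S,cp}$ be the spaces spanned by the functions obtained by applying finitely many quantized continuous affine observables to linear combinations of coherent states. **Proposition.** For holomorphic cylinder functions in $\mathrm{H}^2(\hat L,\nu_L)$, $f|_L$ is the literal restriction; for each $\eta$, the map $f\mapsto f|_L(\cdot-\eta)\alpha^\eta$ is a bijection from $\mathrm{H}^2(\hat L,\nu_L)$ onto $\mathcal{H}^{\hat H}$, and the norm of a wave function does not depend on $\eta$. There is a unique isometric isomorphism $\hat{\mathcal B}:\mathcal{H}^{\tilde S}\to\mathcal{H}^{\hat H}$ that for each base point $\eta\in A$ maps $\hat K^{S,\eta}_\zeta$ to $\hat K^{H}_\zeta$ for all $\zeta\in A$; it does not depend on the base point $\eta$ used to present $\mathcal{H}^{\tilde S}$. Moreover $\mathcal{H}^{\tilde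 S,cp}$ and $\mathcal{H}^{\hat H,cp}$ consist of elements of $\mathcal{H}^{\tilde S}$ and $\mathcal{H}^{\hat H}$ having all the directional derivatives (along $Q$, respectively $L$), they are invariant under all $\check F$, and $\hat{\mathcal B}$ restricts to an isomorphism $\mathcal{H}^{\tilde S,cp}\to\mathcal{H}^{\hat H,cp}$ with $$\hat{\mathcal B}\check F=\check F\hat{\mathcal B}\quad\text{on }\mathcal{H}^{\tilde S,cp}$$ for every continuous affine $F:A\to\mathbb{R}$. -/

import Mathlib

open MeasureTheory ProbabilityTheory
open scoped NNReal ENNReal InnerProductSpace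

noncomputable section

universe u

/-- The cylinder σ-algebra on the algebraic dual of a real vector space. -/
instance algDualMeasurableSpace {V : Type*} [AddCommGroup V] [Module ℝ V] :
    MeasurableSpace (Module.Dual ℝ V) :=
  MeasurableSpace.comap (fun φ v => φ v) MeasurableSpace.pi

/-! Existence and uniqueness of centered Gaussian measures on an algebraic dual. -/

theorem measurable_algDual_eval {V : Type*} [AddCommGroup V] [Module ℝ V] (v : V) :
    Measurable (fun φ : Module.Dual ℝ V => φ v) :=
  (measurable_pi_apply v).comp (comap_measurable (fun (φ : Module.Dual ℝ V) v => φ v))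

theorem continuous_charFun_Lp {Ω : Type*} [MeasurableSpace Ω] (P : Measure Ω)
    [IsProbabilityMeasure P] (t : ℝ) :
    Continuous (fun f : Lp ℝ 2 P => charFun (P.map f) t) := by
  have hform (f : Lp ℝ 2 P) :
      charFun (P.map f) t = ∫ ω, Complex.exp (t * f ω * Complex.I) ∂P := by
    rw [charFun_apply_real, integral_map (Lp.stronglyMeasurable f).aemeasurable (by fun_prop)]
  have hint (f : Lp ℝ 2 P) : Integrable (fun ω => Complex.exp (t * f ω * Complex.I)) P := by
    refine Integrable.of_bound (C := 1) ?_ (.of_forall fun ω => ?_)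
    · have := (Lp.stronglyMeasurable f).measurable
      exact Measurable.aestronglyMeasurable (by fun_prop)
    · rw [← Complex.ofReal_mul, Complex.norm_exp_ofReal_mul_I]
  have hlip : LipschitzWith ‖t‖₊ (fun f : Lp ℝ 2 P => charFun (P.map f) t) := by
    refine LipschitzWith.of_dist_le_mul fun f g => ?_
    rw [dist_eq_norm, dist_eq_norm, hform, hform, ← integral_sub (hint f) (hint g)]
    have hfg : Integrable (fun ω => (f - g : Lp ℝ 2 P) ω) P :=
      (Lp.memLp (f - g)).integrable (by norm_num)
    calc ‖∫ ω, (Complex.exp (t * f ω * Complex.I) - Complex.exp (t * g ω * Complex.I)) ∂P‖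
        ≤ ∫ ω, ‖t‖ * ‖(f - g : Lp ℝ 2 P) ω‖ ∂P := by
          refine norm_integral_le_of_norm_le (hfg.norm.const_mul _) ?_
          filter_upwards [Lp.coeFn_sub f g] with ω hω
          rw [hω, Pi.sub_apply, ← norm_mul, mul_sub]
          have h1 : Complex.exp (t * f ω * Complex.I) - Complex.exp (t * g ω * Complex.I) =
              Complex.exp ((t * g ω : ℝ) * Complex.I) *
                (Complex.exp (Complex.I * ((t * f ω - t * g ω : ℝ))) - 1) := by
            rw [mul_sub, ← Complex.exp_add]
            push_cast
            ring_nf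
          rw [h1, norm_mul, Complex.norm_exp_ofReal_mul_I, one_mul]
          exact Real.norm_exp_I_mul_ofReal_sub_one_le
      _ = ‖t‖ * ∫ ω, ‖(f - g : Lp ℝ 2 P) ω‖ ∂P := integral_const_mul _ _
      _ ≤ ‖t‖ * ‖f - g‖ := by
          gcongr
          rw [integral_norm_eq_lintegral_enorm (Lp.stronglyMeasurable _).aestronglyMeasurable,
            ← eLpNorm_one_eq_lintegral_enorm, Lp.norm_def]
          exact ENNReal.toReal_mono (Lp.eLpNorm_ne_top _)
            (eLpNorm_le_eLpNorm_of_exponent_le (by norm_num)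
              (Lp.stronglyMeasurable _).aestronglyMeasurable)
      _ = _ := by simp
  exact hlip.continuous

theorem exists_linear_gaussian (H : Type u) [NormedAddCommGroup H] [InnerProductSpace ℝ H]
    [CompleteSpace H] :
    ∃ (Ω : Type u) (_ : MeasurableSpace Ω) (P : Measure Ω) (W : H →ₗ[ℝ] Lp ℝ 2 P),
      ∀ h : H, P.map (W h) = gaussianReal 0 (‖h‖₊ ^ 2) := by
  obtain ⟨w, e, -⟩ := exists_hilbertBasis ℝ H
  let P : Measure (w → ℝ) := Measure.infinitePi (fun _ => gaussianReal 0 1)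
  have hlaw (i : w) : P.map (fun ω => ω i) = gaussianReal 0 1 := Measure.infinitePi_map_eval _ i
  have hmem (i : w) : MemLp (fun ω : w → ℝ => ω i) 2 P := by
    have h := memLp_id_gaussianReal (μ := 0) (v := 1) 2
    rw [← hlaw i] at h
    exact h.comp_of_map (measurable_pi_apply i).aemeasurable
  have hind : iIndepFun (fun (i : w) (ω : w → ℝ) => ω i) P :=
    iIndepFun_infinitePi (X := fun _ x => x) (fun _ => measurable_id)
  have hmean (i : w) : ∫ ω, ω i ∂P = 0 := by
    have h := integral_id_gaussianReal (μ := 0) (v := 1)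
    rw [← hlaw i, integral_map (measurable_pi_apply i).aemeasurable (by fun_prop)] at h
    exact h
  have horth : Orthonormal ℝ (fun i => (hmem i).toLp) := by
    classical
    rw [orthonormal_iff_ite]
    intro i j
    have h0 : inner ℝ ((hmem i).toLp) ((hmem j).toLp) = ∫ ω, ω i * ω j ∂P := by
      rw [L2.inner_def]
      refine integral_congr_ae ?_
      filter_upwards [(hmem i).coeFn_toLp, (hmem j).coeFn_toLp] with ω h1 h2
      rw [h1, h2]
      simp [mul_comm]
    rw [h0]
    split_ifs with hij
    · subst hij
      have h := variance_id_gaussianReal (μ := 0) (v := 1)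
      rw [← hlaw i, variance_eq_integral aemeasurable_id,
        integral_map (measurable_pi_apply i).aemeasurable (by fun_prop),
        integral_map (measurable_pi_apply i).aemeasurable (by fun_prop)] at h
      simpa [hmean, sq] using h
    · rw [(hind.indepFun hij).integral_fun_mul_eq_mul_integral
        (measurable_pi_apply i).aestronglyMeasurable (measurable_pi_apply j).aestronglyMeasurable,
        hmean, zero_mul]
  let W : H →ₗᵢ[ℝ] Lp ℝ 2 P := horth.orthogonalFamily.linearIsometry.comp
    e.repr.toLinearIsometry
  have hWe (i : w) : W (e i) = (hmem i).toLp := by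
    classical
    simp [W, OrthogonalFamily.linearIsometry_apply_single, HilbertBasis.repr_self]
  refine ⟨w → ℝ, inferInstance, P, W.toLinearMap, fun h => ?_⟩
  have : IsProbabilityMeasure (P.map (W h)) :=
    Measure.isProbabilityMeasure_map (Lp.stronglyMeasurable _).aemeasurable
  refine Measure.ext_of_charFun ?_
  ext t
  have hclosed : IsClosed {h : H | charFun (P.map (W h)) t =
      charFun (gaussianReal 0 (‖h‖₊ ^ 2)) t} := by
    refine isClosed_eq ((continuous_charFun_Lp P t).comp W.continuous) ?_
    simp only [charFun_gaussianReal]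
    push_cast
    fun_prop
  suffices hs : (Submodule.span ℝ (Set.range e) : Set H) ⊆ {h : H | charFun (P.map (W h)) t =
      charFun (gaussianReal 0 (‖h‖₊ ^ 2)) t} by
    have := hclosed.closure_subset_iff.mpr hs
    have hd := e.dense_span
    rw [← Submodule.topologicalClosure_coe, hd] at this
    exact this (Set.mem_univ h)
  intro x hx
  obtain ⟨c, rfl⟩ := (Finsupp.mem_span_range_iff_exists_finsupp).mp hx
  have hae : (W (c.sum fun i a => a • e i) : (w → ℝ) → ℝ) =ᵐ[P]
      ∑ i ∈ c.support, fun ω : w → ℝ => c i * ω i := by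
    have h1 : W (c.sum fun i a => a • e i) = ∑ i ∈ c.support, c i • (hmem i).toLp := by
      simp [Finsupp.sum, map_sum, hWe]
    rw [h1]
    refine (Lp.coeFn_finsetSum _ _).trans ?_
    have h2 : ∀ᵐ ω ∂P, ∀ i ∈ c.support, (c i • (hmem i).toLp : Lp ℝ 2 P) ω = c i * ω i := by
      rw [Finset.eventually_all]
      intro i _
      filter_upwards [Lp.coeFn_smul (c i) (hmem i).toLp, (hmem i).coeFn_toLp] with ω h3 h4
      simp [h3, h4]
    filter_upwards [h2] with ω hω
    rw [Finset.sum_apply, Finset.sum_apply]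
    exact Finset.sum_congr rfl hω
  show charFun (P.map (W (c.sum fun i a => a • e i))) t = _
  rw [Measure.map_congr hae, iIndepFun.charFun_map_finsetSum_eq_prod
    (fun i _ => ((measurable_pi_apply i).const_mul _).aemeasurable)
    ((hind.comp (fun i x => c i * x) (fun i => measurable_const_mul _)).restrict c.support)]
  have hnorm : ‖c.sum fun i a => a • e i‖ ^ 2 = ∑ i ∈ c.support, c i ^ 2 := by
    rw [Finsupp.sum, ← real_inner_self_eq_norm_sq, e.orthonormal.inner_sum]
    simp [sq]
  have hl (i : w) : P.map (fun ω => c i * ω i) = gaussianReal 0 (.mk (c i ^ 2) (sq_nonneg _)) := by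
    have := gaussianReal_map_const_mul (μ := 0) (v := 1) (c i)
    rw [← hlaw i, Measure.map_map (by fun_prop) (by fun_prop)] at this
    simpa [Function.comp_def] using this
  simp only [Finset.prod_apply, hl, charFun_gaussianReal, ← Complex.exp_sum]
  congr 1
  push_cast
  rw [← Complex.ofReal_pow ‖_‖, hnorm]
  simp [Finset.sum_div, Finset.sum_mul, Finset.sum_neg_distrib]

theorem exists_algDual_gaussian {V : Type*} {H : Type u} [AddCommGroup V] [Module ℝ V]
    [NormedAddCommGroup H] [InnerProductSpace ℝ H] [CompleteSpace H] (r : V →ₗ[ℝ] H) (c : ℝ≥0) :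
    ∃ ν : Measure (Module.Dual ℝ V), ∀ v : V,
      ν.map (fun φ => φ v) = gaussianReal 0 (c * ‖r v‖₊ ^ 2) := by
  obtain ⟨Ω, _, P, W, hW⟩ := exists_linear_gaussian H
  let b := Module.Basis.ofVectorSpace ℝ V
  let s : ℝ := Real.sqrt c
  let Φ : Ω → Module.Dual ℝ V := fun ω => b.constr ℝ (fun k => W (s • r (b k)) ω)
  have hΦ (v : V) (ω) : Φ ω v = (b.repr v).sum fun k a => a * W (s • r (b k)) ω := by
    simp [Φ, Module.Basis.constr_apply]
  have hmeas (v : V) : Measurable (fun ω => Φ ω v) := by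
    simp only [hΦ, Finsupp.sum]
    exact Finset.measurable_fun_sum _ fun k _ =>
      ((Lp.stronglyMeasurable (W (s • r (b k)))).measurable.const_mul _)
  have hΦm : Measurable Φ := by
    rw [measurable_comap_iff]
    exact measurable_pi_lambda _ hmeas
  refine ⟨P.map Φ, fun v => ?_⟩
  rw [Measure.map_map (measurable_algDual_eval v) hΦm]
  have hae : (fun ω => Φ ω v) =ᵐ[P] W (s • r v) := by
    have h1 : W (s • r v) = ∑ k ∈ (b.repr v).support, (b.repr v k) • W (s • r (b k)) := by
      conv_lhs => rw [← b.linearCombination_repr v, Finsupp.linearCombination_apply, Finsupp.sum]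
      simp only [map_sum, map_smul, Finset.smul_sum]
      exact Finset.sum_congr rfl fun k _ => smul_comm _ _ _
    rw [h1]
    refine .trans ?_ (Lp.coeFn_finsetSum _ _).symm
    have h2 : ∀ᵐ ω ∂P, ∀ k ∈ (b.repr v).support,
        ((b.repr v k) • W (s • r (b k)) : Lp ℝ 2 P) ω = (b.repr v k) * W (s • r (b k)) ω := by
      rw [Finset.eventually_all]
      intro k _
      filter_upwards [Lp.coeFn_smul (b.repr v k) (W (s • r (b k)))] with ω hω
      simpa using hω
    filter_upwards [h2] with ω hω
    rw [hΦ, Finsupp.sum, Finset.sum_apply]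
    exact Finset.sum_congr rfl fun k hk => (hω k hk).symm
  have : P.map ((fun φ : Module.Dual ℝ V => φ v) ∘ Φ) = P.map (W (s • r v)) :=
    Measure.map_congr hae
  rw [this, hW]
  congr 1
  ext
  simp [norm_smul, s, mul_pow]

theorem algDual_measure_ext {V : Type*} [AddCommGroup V] [Module ℝ V]
    {ν ν' : Measure (Module.Dual ℝ V)} [IsFiniteMeasure ν] [IsFiniteMeasure ν']
    (h : ∀ v : V, ν.map (fun φ => φ v) = ν'.map (fun φ => φ v)) : ν = ν' := by
  let T : Module.Dual ℝ V → V → ℝ := fun φ v => φ v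
  have hT : Measurable T := comap_measurable _
  have hmap : ν.map T = ν'.map T := by
    refine IsProjectiveLimit.unique (P := fun I : Finset V => (ν.map T).map I.restrict)
      (fun I => rfl) fun I => ?_
    classical
    refine Measure.ext_of_charFunDual ?_
    ext L
    have hL (φ : Module.Dual ℝ V) : L (I.restrict (T φ)) =
        φ (∑ v : I, L (Pi.single v 1) • (v : V)) := by
      rw [map_sum]
      refine (L.toLinearMap.pi_apply_eq_sum_univ (I.restrict (T φ))).trans
        (Finset.sum_congr rfl fun v _ => ?_)
      rw [map_smul, smul_eq_mul, smul_eq_mul, mul_comm]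
      have : (fun k => if v = k then (1 : ℝ) else 0) = Pi.single v 1 := by
        ext k
        simp [Pi.single_apply, eq_comm]
      rw [this]
      rfl
    have key (μ : Measure (Module.Dual ℝ V)) : charFunDual ((μ.map T).map I.restrict) L =
        charFun (μ.map (fun φ => φ (∑ v : I, L (Pi.single v 1) • (v : V)))) 1 := by
      rw [charFunDual_apply, charFun_apply_real, Measure.map_map (by fun_prop) hT,
        integral_map (by fun_prop) (by fun_prop),
        integral_map (measurable_algDual_eval _).aemeasurable (by fun_prop)]
      simp [hL]
    rw [key, key, h]
  ext s hs
  obtain ⟨t, ht, rfl⟩ := hs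
  have := congrArg (fun μ => μ t) hmap
  simpa [Measure.map_apply hT ht] using this

/-- The canonical inclusion of `E` into the algebraic dual of its topological dual. -/
def bidualIncl (E : Type*) [SeminormedAddCommGroup E] [NormedSpace ℝ E] :
    E →ₗ[ℝ] Module.Dual ℝ (StrongDual ℝ E) where
  toFun x := { toFun := fun l => l x, map_add' := fun _ _ => rfl, map_smul' := fun _ _ => rfl }
  map_add' x y := by ext l; exact map_add l x y
  map_smul' a x := by ext l; exact map_smul l a x

/-- `ν` is the centered Gaussian measure on the algebraic dual of the topological dual of `E`
under which each evaluation `φ ↦ φ l` has variance `c * ‖l‖ ^ 2`. Evaluations being linear in `l`,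
this fixes all finite-dimensional marginals. -/
def IsBidualGaussian {E : Type*} [SeminormedAddCommGroup E] [NormedSpace ℝ E] (c : ℝ≥0)
    (ν : Measure (Module.Dual ℝ (StrongDual ℝ E))) : Prop :=
  ∀ l : StrongDual ℝ E, ν.map (fun φ => φ l) = gaussianReal 0 (c * ‖l‖₊ ^ 2)

theorem IsBidualGaussian.isProbabilityMeasure {E : Type*} [SeminormedAddCommGroup E]
    [NormedSpace ℝ E] {c : ℝ≥0} {ν : Measure (Module.Dual ℝ (StrongDual ℝ E))}
    (h : IsBidualGaussian c ν) : IsProbabilityMeasure ν := by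
  have h0 := h 0
  have h1 : ν.map (fun φ => φ 0) Set.univ = 1 := by rw [h0]; exact measure_univ
  rw [Measure.map_apply (measurable_algDual_eval _) MeasurableSet.univ] at h1
  exact ⟨by simpa using h1⟩

theorem IsBidualGaussian.unique {E : Type*} [SeminormedAddCommGroup E]
    [NormedSpace ℝ E] {c : ℝ≥0} {ν ν' : Measure (Module.Dual ℝ (StrongDual ℝ E))}
    (h : IsBidualGaussian c ν) (h' : IsBidualGaussian c ν') : ν = ν' := by
  have := h.isProbabilityMeasure
  have := h'.isProbabilityMeasure
  exact algDual_measure_ext fun l => (h l).trans (h' l).symm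

theorem exists_isBidualGaussian_quotient {L : Type u} [NormedAddCommGroup L]
    [InnerProductSpace ℝ L] [CompleteSpace L] (M : Submodule ℝ L) (c : ℝ≥0) :
    ∃ ν : Measure (Module.Dual ℝ (StrongDual ℝ (L ⧸ M))), IsBidualGaussian c ν := by
  have hnorm (l : StrongDual ℝ (L ⧸ M)) : ‖l.comp M.mkQL‖₊ = ‖l‖₊ := by
    ext
    refine le_antisymm ?_ ?_
    · refine ContinuousLinearMap.opNorm_le_bound _ (norm_nonneg _) fun x => ?_
      exact (l.le_opNorm _).trans
        (mul_le_mul_of_nonneg_left (Submodule.Quotient.norm_mk_le M x) (norm_nonneg l))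
    · refine ContinuousLinearMap.opNorm_le_bound _ (norm_nonneg _) fun x => ?_
      refine le_of_forall_pos_le_add fun ε hε => ?_
      set K := ‖l.comp M.mkQL‖ with hK
      have hK0 : 0 ≤ K := norm_nonneg _
      obtain ⟨m, rfl, hm⟩ := Submodule.Quotient.norm_mk_lt x (show 0 < ε / (K + 1) by positivity)
      have h1 : ‖l (Submodule.Quotient.mk m)‖ ≤ K * ‖m‖ := (l.comp M.mkQL).le_opNorm m
      have h2 : K * (ε / (K + 1)) ≤ ε := by
        rw [mul_div_assoc', div_le_iff₀ (by positivity)]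
        nlinarith
      have h3 := mul_le_mul_of_nonneg_left hm.le hK0
      rw [mul_add] at h3
      exact h1.trans (h3.trans (by gcongr; exact le_rfl))
  let r : StrongDual ℝ (L ⧸ M) →ₗ[ℝ] L :=
    { toFun := fun l => (InnerProductSpace.toDual ℝ L).symm (l.comp M.mkQL)
      map_add' := fun l l' => by rw [ContinuousLinearMap.add_comp, map_add]
      map_smul' := fun a l => by rw [ContinuousLinearMap.smul_comp]; simp }
  obtain ⟨ν, hν⟩ := exists_algDual_gaussian r c
  refine ⟨ν, fun l => ?_⟩
  rw [hν l, ← hnorm l]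
  congr 3
  exact (InnerProductSpace.toDual ℝ L).symm.nnnorm_map _

theorem exists_isBidualGaussian {L : Type u} [NormedAddCommGroup L]
    [InnerProductSpace ℝ L] [CompleteSpace L] (c : ℝ≥0) :
    ∃ ν : Measure (Module.Dual ℝ (StrongDual ℝ L)), IsBidualGaussian c ν := by
  obtain ⟨ν, hν⟩ := exists_algDual_gaussian
    ((InnerProductSpace.toDual ℝ L).symm.toLinearEquiv.toLinearMap) c
  refine ⟨ν, fun l => ?_⟩
  rw [hν l]
  congr 3
  exact (InnerProductSpace.toDual ℝ L).symm.nnnorm_map _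

/-- The symplectic form `ω(ξ, τ) = ½ [ξ, τ] - ½ [τ, ξ]`. -/
def symplecticForm {L : Type*} [NormedAddCommGroup L] [InnerProductSpace ℝ L]
    (br : L →L[ℝ] L →L[ℝ] ℝ) (ξ τ : L) : ℝ :=
  1 / 2 * br ξ τ - 1 / 2 * br τ ξ

/-- `M = {τ : [ξ, τ] = 0 for all ξ}`. -/
def momentumSpace {L : Type*} [NormedAddCommGroup L] [InnerProductSpace ℝ L]
    (br : L →L[ℝ] L →L[ℝ] ℝ) : Submodule ℝ L where
  carrier := {τ | ∀ ξ, br ξ τ = 0}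
  add_mem' ha hb ξ := by rw [map_add, ha ξ, hb ξ, add_zero]
  zero_mem' ξ := map_zero _
  smul_mem' a τ h ξ := by rw [map_smul, h ξ, smul_zero]

/-- `N = {τ : [τ, ξ] = 0 for all ξ}`. -/
def conjugateSpace {L : Type*} [NormedAddCommGroup L] [InnerProductSpace ℝ L]
    (br : L →L[ℝ] L →L[ℝ] ℝ) : Submodule ℝ L :=
  momentumSpace br.flip

/-- The data of an affine field theory with a complex structure. `A` is the affine space of
solutions over `L`; the inner product of the real separable Hilbert space `L` is the form
`g(τ, ξ) = 2 ω(τ, J ξ)`, so the topologies of `L` and `A` are those defined by `g`. -/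
structure AffineFieldTheory (L A : Type*) [NormedAddCommGroup L] [InnerProductSpace ℝ L]
    [CompleteSpace L] [TopologicalSpace.SeparableSpace L] [MetricSpace A]
    [NormedAddTorsor L A] where
  /-- the continuous bilinear form `[·, ·]` -/
  br : L →L[ℝ] L →L[ℝ] ℝ
  /-- the symplectic potential -/
  θ : A → L →ₗ[ℝ] ℝ
  θ_vadd : ∀ (η : A) (ξ τ : L), θ (ξ +ᵥ η) τ = θ η τ + br ξ τ
  /-- `θ` is adapted to the real polarization `M`. -/
  θ_adapted : ∀ (η : A), ∀ τ ∈ momentumSpace br, θ η τ = 0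
  nondegenerate : ∀ ξ, (∀ τ, symplecticForm br ξ τ = 0) → ξ = 0
  sup_eq_top : momentumSpace br ⊔ conjugateSpace br = ⊤
  /-- the complex structure -/
  J : L →ₗ[ℝ] L
  J_J : ∀ ξ, J (J ξ) = -ξ
  J_symplectic : ∀ ξ τ, symplecticForm br (J ξ) (J τ) = symplecticForm br ξ τ
  inner_eq : ∀ τ ξ : L, ⟪τ, ξ⟫_ℝ = 2 * symplecticForm br τ (J ξ)

namespace AffineFieldTheory

variable {L : Type u} {A : Type*} [NormedAddCommGroup L] [InnerProductSpace ℝ L]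
  [CompleteSpace L] [TopologicalSpace.SeparableSpace L] [MetricSpace A] [NormedAddTorsor L A]
  (T : AffineFieldTheory L A)

/-- The Lagrangian subspace `M` of the Schrödinger polarization. -/
abbrev M : Submodule ℝ L := momentumSpace T.br

/-- `Q = L / M` with the quotient norm. -/
abbrev Q : Type u := L ⧸ T.M

/-- The quotient map `q : L → Q`. -/
abbrev q : L →L[ℝ] T.Q := T.M.mkQL

/-- The enlarged configuration space: the algebraic dual of the topological dual of `Q`. -/
abbrev QHat : Type u := Module.Dual ℝ (StrongDual ℝ T.Q)

/-- The inclusion of `Q` into `QHat`. -/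
abbrev inclQ : T.Q →ₗ[ℝ] T.QHat := bidualIncl T.Q

/-- The space of solutions enlarged to the algebraic dual of the topological dual of `L`. -/
abbrev LHat (_ : AffineFieldTheory L A) : Type u := Module.Dual ℝ (StrongDual ℝ L)

/-- The inclusion of `L` into `LHat`. -/
abbrev inclL : L →ₗ[ℝ] T.LHat := bidualIncl L

/-- The symplectic form. -/
abbrev ω (ξ τ : L) : ℝ := symplecticForm T.br ξ τ

theorem isClosed_M : IsClosed (T.M : Set L) := by
  have : (T.M : Set L) = ⋂ ξ, {τ | T.br ξ τ = 0} := by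
    ext τ; simp [momentumSpace]
  rw [this]
  exact isClosed_iInter fun ξ => isClosed_eq (T.br ξ).continuous continuous_const

theorem map_J_le_orthogonal : T.M.map T.J ≤ T.Mᗮ := by
  rintro _ ⟨ξ, hξ, rfl⟩
  intro τ hτ
  rw [T.inner_eq, T.J_J]
  have h1 : T.br τ ξ = 0 := hξ τ
  have h2 : T.br ξ τ = 0 := hτ ξ
  simp [symplecticForm, h1, h2]

theorem orthogonal_le_map_J : T.Mᗮ ≤ T.M.map T.J := by
  intro σ hσ
  have hJ : T.J σ ∈ T.M := by
    intro ξ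
    obtain ⟨m, hm, n, hn, rfl⟩ := Submodule.mem_sup.mp
      (show ξ ∈ momentumSpace T.br ⊔ conjugateSpace T.br by rw [T.sup_eq_top]; trivial)
    have h1 : T.br n (T.J σ) = 0 := hn (T.J σ)
    have h2 : T.br (T.J σ) m = 0 := hm (T.J σ)
    have h3 : ⟪m, σ⟫_ℝ = 0 := hσ m hm
    rw [T.inner_eq, symplecticForm, h2] at h3
    rw [map_add, add_apply, h1]
    linarith
  exact ⟨-T.J σ, T.M.neg_mem hJ, by rw [map_neg, T.J_J, neg_neg]⟩

theorem M_le_ker : T.M ≤ (T.Mᗮ.starProjection : L →L[ℝ] L).ker := by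
  intro τ hτ
  rw [LinearMap.mem_ker]
  exact (Submodule.starProjection_apply_eq_zero_iff _).mpr (Submodule.le_orthogonal_orthogonal _ hτ)

/-- The section `j : Q → L` of `q` with range `J M`; since `J M` is the orthogonal complement of
`M`, it is induced by the orthogonal projection onto `Mᗮ`. -/
def j : T.Q →L[ℝ] L := T.M.liftQL T.Mᗮ.starProjection T.M_le_ker

theorem q_j (φ : T.Q) : T.q (T.j φ) = φ := by
  obtain ⟨ξ, rfl⟩ := T.M.mkQ_surjective φ
  have : T.j (T.M.mkQ ξ) = T.Mᗮ.starProjection ξ := rfl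
  rw [this, T.M.mkQL_apply, ← sub_eq_zero, ← map_sub, Submodule.mkQ_apply,
    Submodule.Quotient.mk_eq_zero]
  have h := Submodule.sub_starProjection_mem_orthogonal (K := T.Mᗮ) ξ
  rw [Submodule.orthogonal_orthogonal_eq_closure, T.isClosed_M.submodule_topologicalClosure_eq] at h
  simpa using T.M.neg_mem h

theorem j_mem (φ : T.Q) : T.j φ ∈ T.M.map T.J := by
  obtain ⟨ξ, rfl⟩ := T.M.mkQ_surjective φ
  exact T.orthogonal_le_map_J (Submodule.starProjection_apply_mem _ ξ)

theorem j_unique (j' : T.Q →ₗ[ℝ] L) (h1 : ∀ φ, T.q (j' φ) = φ)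
    (h2 : ∀ φ, j' φ ∈ T.M.map T.J) : j' = T.j := by
  ext ξ
  set φ : T.Q := T.M.mkQ ξ
  have hM : j' φ - T.j φ ∈ T.M := by
    rw [← Submodule.Quotient.mk_eq_zero, ← Submodule.mkQ_apply, ← T.M.mkQL_apply, map_sub,
      h1, T.q_j, sub_self]
  have hO : j' φ - T.j φ ∈ T.Mᗮ := T.map_J_le_orthogonal (sub_mem (h2 φ) (T.j_mem φ))
  have := hO _ hM
  exact sub_eq_zero.mp (inner_self_eq_zero.mp this)

theorem M_le_ker_br (ξ : L) : T.M ≤ (T.br ξ).ker := fun _ hτ => hτ ξ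

/-- The functional `φ ↦ [ξ, φ]` on `Q`. -/
def brQ (ξ : L) : StrongDual ℝ T.Q := T.M.liftQL (T.br ξ) (T.M_le_ker_br ξ)

/-- The functional `φ ↦ g(j χ, j φ)`, the real part of `φ ↦ Ω(χ, φ)`. -/
def gQ (χ : T.Q) : StrongDual ℝ T.Q := (innerSL ℝ (T.j χ)).comp T.j

/-- `Ω(χ, φ) = g(j χ, j φ) - i [j χ, φ]`. -/
def Ω (χ φ : T.Q) : ℂ := ⟪T.j χ, T.j φ⟫_ℝ - Complex.I * T.brQ (T.j χ) φ

/-- The canonical extension of `φ ↦ Ω(χ, φ)` to `QHat`. -/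
def ΩHat (χ : T.Q) (φ : T.QHat) : ℂ := φ (T.gQ χ) - Complex.I * φ (T.brQ (T.j χ))

theorem ΩHat_incl (χ φ : T.Q) : T.ΩHat χ (T.inclQ φ) = T.Ω χ φ := rfl

/-- The functional `ω(τ, ·)` on `L`. -/
def ωL (τ : L) : StrongDual ℝ L := (1 / 2 : ℝ) • T.br τ - (1 / 2 : ℝ) • T.br.flip τ

/-- The form `{τ, ξ} = g(τ, ξ) + 2 i ω(τ, ξ)`. -/
def herm (τ ξ : L) : ℂ := ⟪τ, ξ⟫_ℝ + 2 * Complex.I * T.ω τ ξ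

/-- The canonical extension of `{τ, ·}` to `LHat`. -/
def hermHat (τ : L) (φ : T.LHat) : ℂ := φ (innerSL ℝ τ) + 2 * Complex.I * φ (T.ωL τ)

theorem hermHat_incl (τ ξ : L) : T.hermHat τ (T.inclL ξ) = T.herm τ ξ := by
  simp [hermHat, herm, bidualIncl, ωL, symplecticForm]

/-- The Gaussian measure on `QHat`, formally `exp(-g(j φ, j φ)) dφ`: variances `½ ‖l‖ ^ 2`. -/
def νQ : Measure T.QHat := (exists_isBidualGaussian_quotient T.M (1 / 2)).choose

theorem νQ_spec : IsBidualGaussian (1 / 2) T.νQ :=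
  (exists_isBidualGaussian_quotient T.M (1 / 2)).choose_spec

/-- The Gaussian measure on `LHat`, formally `exp(-½ g(ξ, ξ)) dξ`: variances `‖l‖ ^ 2`. -/
def νL : Measure T.LHat := (exists_isBidualGaussian (L := L) 1).choose

theorem νL_spec : IsBidualGaussian 1 T.νL := (exists_isBidualGaussian (L := L) 1).choose_spec

/-! The holomorphic representation. -/

/-- Holomorphic cylinder functions on `LHat`: entire functions of finitely many continuous
complex-linear functionals. By Riesz, the latter are the `{τ, ·}`. -/
def IsCylinderHolomorphic (f : T.LHat → ℂ) : Prop :=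
  ∃ (n : ℕ) (τ : Fin n → L) (p : (Fin n → ℂ) → ℂ), Differentiable ℂ p ∧
    ∀ φ, f φ = p (fun i => T.hermHat (τ i) φ)

/-- The Hilbert space `H²(LHat, νL)` of square-integrable holomorphic functions, as the closure in
`L²` of the square-integrable holomorphic cylinder functions. -/
def H2 : Submodule ℂ (Lp ℂ 2 T.νL) :=
  (Submodule.span ℂ {f : Lp ℂ 2 T.νL |
    ∃ p, T.IsCylinderHolomorphic p ∧ f =ᵐ[T.νL] p}).topologicalClosure

/-- The coherent wave functions `exp(½ {τ, ·})` of the linear theory. -/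
def coherentL (τ : L) (φ : T.LHat) : ℂ := Complex.exp (1 / 2 * T.hermHat τ φ)

/-- The restriction to `L` of a square-integrable holomorphic function on `LHat`: since `L` is a
null set in general, it is the pairing with coherent states, which on holomorphic cylinder
functions is evaluation. -/
def restrictL (f : T.H2) (ξ : L) : ℂ :=
  ∫ φ, starRingEnd ℂ (T.coherentL ξ φ) * (f : Lp ℂ 2 T.νL) φ ∂T.νL

/-- The function `α^η` on `A`. -/
def α (η ζ : A) : ℂ :=
  Complex.exp (Complex.I / 2 * T.θ η (ζ -ᵥ η) + Complex.I / 2 * T.θ ζ (ζ -ᵥ η)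
    - 1 / 4 * ⟪ζ -ᵥ η, ζ -ᵥ η⟫_ℝ)

/-- The wave function on `A` of the state presented, relative to the base point `η`, by `f`. -/
def waveH (η : A) (f : T.H2) (ζ : A) : ℂ := T.restrictL f (ζ -ᵥ η) * T.α η ζ

/-- The wave functions on `A` of the states of the holomorphic representation. -/
def HHat : Set (A → ℂ) := {ψ | ∃ (η : A) (f : T.H2), ψ = T.waveH η f}

/-- The wave function of the affine coherent state associated to `η`. -/
def coherentH (η : A) (ζ : A) : ℂ := T.α η ζ

/-- The span of the affine coherent states. -/
def HHat_c : Submodule ℂ (A → ℂ) := Submodule.span ℂ (Set.range T.coherentH)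

/-! The Schrödinger representation. -/

/-- The `η`-reduced Schrödinger wave function of the affine coherent state associated to `ζ`. -/
def coherentS (η ζ : A) (φ : T.QHat) : ℂ :=
  Complex.exp (Complex.I * T.θ ζ (η -ᵥ ζ) - 1 / 2 * T.Ω (T.q (η -ᵥ ζ)) (T.q (η -ᵥ ζ))
    - Complex.I * φ (T.brQ (η -ᵥ ζ)) - T.ΩHat (T.q (η -ᵥ ζ)) φ)

/-- The span of the `η`-reduced wave functions of the affine coherent states. -/
def HS_c (η : A) : Submodule ℂ (T.QHat → ℂ) := Submodule.span ℂ (Set.range (T.coherentS η))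

/-! Quantization of continuous affine observables. -/

/-- The Hamiltonian vector `X_F` of a continuous affine observable. -/
def X (F : A →ᴬ[ℝ] ℝ) : L := T.J ((InnerProductSpace.toDual ℝ L).symm F.contLinear)

theorem X_spec (F : A →ᴬ[ℝ] ℝ) (ξ : L) : 2 * T.ω ξ (T.X F) = F.contLinear ξ := by
  rw [X, ← T.inner_eq, real_inner_comm, InnerProductSpace.toDual_symm_apply]

/-- The quantization of `F` on wave functions on `A`. -/
def quantH (F : A →ᴬ[ℝ] ℝ) (ψ : A → ℂ) (ζ : A) : ℂ :=
  (F ζ - T.θ ζ (T.X F) : ℝ) * ψ ζ - Complex.I * deriv (fun t : ℝ => ψ (t • T.X F +ᵥ ζ)) 0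

/-- The quantization of `F` on `η`-reduced Schrödinger wave functions. -/
def quantS (η : A) (F : A →ᴬ[ℝ] ℝ) (ψ : T.QHat → ℂ) (φ : T.QHat) : ℂ :=
  (F η - φ (T.brQ (T.X F)) + Complex.I * T.ΩHat (T.q (T.X F)) φ) * ψ φ
    - Complex.I * deriv (fun t : ℝ => ψ (φ + t • T.inclQ (T.q (T.X F)))) 0

/-- The span of the functions obtained by applying finitely many quantized continuous affine
observables to elements of the span of the affine coherent states. -/
def HHat_cp : Submodule ℂ (A → ℂ) :=
  Submodule.span ℂ {χ | ∃ (Fs : List (A →ᴬ[ℝ] ℝ)), ∃ ψ ∈ T.HHat_c, χ = Fs.foldr T.quantH ψ}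

/-- The same, for `η`-reduced Schrödinger wave functions. -/
def HS_cp (η : A) : Submodule ℂ (T.QHat → ℂ) :=
  Submodule.span ℂ {χ | ∃ (Fs : List (A →ᴬ[ℝ] ℝ)), ∃ ψ ∈ T.HS_c η, χ = Fs.foldr (T.quantS η) ψ}

/-- The set of states in `L²(QHat, νQ)` represented by elements of `HS_cp η`. -/
def HS_cpL2 (η : A) : Set (Lp ℂ 2 T.νQ) := {f | ∃ ψ ∈ T.HS_cp η, f =ᵐ[T.νQ] ψ}

/-- `B` is the isomorphism of Hilbert spaces from the Schrödinger to the holomorphic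
representation that preserves coherent states. For each base point `η`, the source is presented by
`η`-reduced wave functions and the target by holomorphic functions as in `waveH η`. -/
def IsCoherentIso (B : A → (Lp ℂ 2 T.νQ ≃ₗᵢ[ℂ] T.H2)) : Prop :=
  ∀ η ζ : A, ∃ h : MemLp (T.coherentS η ζ) 2 T.νQ,
    T.waveH η (B η (h.toLp (T.coherentS η ζ))) = T.coherentH ζ

end AffineFieldTheory

end

/-! Both representations carry a family of coherent states indexed by `A` whose linear span is
dense, and the two families have the same Gram matrix, with entries `α ζ' ζ`; this determines the
isometry.

On the holomorphic side the coherent states are reproducing: by the Cameron–Martin formula, pairing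
a holomorphic cylinder function with the coherent state of `ξ` amounts to averaging its translate by
`ξ` over the Gaussian measure, which is invariant under the rotations `exp(t J)`, so that the mean
value property evaluates the average at the centre. On the Schrödinger side the Gram matrix is a
Gaussian integral, and a change of base point is a Cameron–Martin shift.

Consequently the isometry is the coherent state transform `waveS`, the pairing of a state with all
coherent states. Differentiating this pairing with respect to the coherent state multiplies the
integrand by a linear function, and Gaussian integration by parts turns this multiplication into the
derivative that occurs in the Schrödinger quantization of an observable. -/

noncomputable section

/-! ### Measures on algebraic duals -/

section AlgDual

variable {V : Type*} [AddCommGroup V] [Module ℝ V]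

theorem measurable_algDual_iff {Ω : Type*} [MeasurableSpace Ω] {f : Ω → Module.Dual ℝ V} :
    Measurable f ↔ ∀ v, Measurable fun ω => f ω v := by
  rw [measurable_comap_iff]
  exact measurable_pi_iff

/-- Translation by `h` on an algebraic dual, as a measurable equivalence; the cylinder σ-algebra
carries no `MeasurableAdd` instance to take it from. -/
def algDualShift (h : Module.Dual ℝ V) : Module.Dual ℝ V ≃ᵐ Module.Dual ℝ V where
  toEquiv := Equiv.addRight h
  measurable_toFun := measurable_algDual_iff.2 fun v =>
    (measurable_algDual_eval v).add_const (h v)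
  measurable_invFun := measurable_algDual_iff.2 fun v =>
    (measurable_algDual_eval v).add_const ((-h) v)

theorem algDualShift_apply (h φ : Module.Dual ℝ V) : algDualShift h φ = φ + h := rfl

theorem algDual_measure_ext_of_integral_exp {ν ν' : Measure (Module.Dual ℝ V)}
    [IsFiniteMeasure ν] [IsFiniteMeasure ν']
    (hν : ∀ v, Integrable (fun φ => Real.exp (φ v)) ν)
    (h : ∀ v, ∫ φ, Real.exp (φ v) ∂ν = ∫ φ, Real.exp (φ v) ∂ν') : ν = ν' := by
  refine algDual_measure_ext fun v => Measure.ext_of_complexMGF_eq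
    (measurable_algDual_eval v).aemeasurable (measurable_algDual_eval v).aemeasurable ?_
  have integrableExpSet_eq : integrableExpSet (fun φ : Module.Dual ℝ V => φ v) ν = Set.univ :=
    Set.eq_univ_of_forall fun t => by simpa [integrableExpSet] using hν (t • v)
  have mgf_eq : mgf (fun φ : Module.Dual ℝ V => φ v) ν = mgf (fun φ => φ v) ν' := by
    ext t
    simpa [mgf] using h (t • v)
  have zero_iff : ν = 0 ↔ ν' = 0 := by
    have mass_eq : ν.real Set.univ = ν'.real Set.univ := by simpa using h 0
    rw [← Measure.measure_univ_eq_zero, ← Measure.measure_univ_eq_zero,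
      ← measureReal_eq_zero_iff, ← measureReal_eq_zero_iff, mass_eq]
  ext z
  exact eqOn_complexMGF_of_mgf' mgf_eq zero_iff (by simp [integrableExpSet_eq])

end AlgDual

section TotalExponentials

theorem integral_withDensity_ofReal {Ω : Type*} [MeasurableSpace Ω] {μ : Measure Ω} {f : Ω → ℝ}
    (hf : AEMeasurable f μ) (G : Ω → ℝ) :
    ∫ x, G x ∂μ.withDensity (fun x => ENNReal.ofReal (f x)) = ∫ x, G x * max (f x) 0 ∂μ := by
  rw [integral_withDensity_eq_integral_toReal_smul₀ hf.ennreal_ofReal (by simp)]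
  simp only [ENNReal.toReal_ofReal', smul_eq_mul, mul_comm]

theorem integrable_withDensity_ofReal_iff {Ω : Type*} [MeasurableSpace Ω] {μ : Measure Ω}
    {f : Ω → ℝ} (hf : AEMeasurable f μ) {G : Ω → ℝ} :
    Integrable G (μ.withDensity fun x => ENNReal.ofReal (f x)) ↔
      Integrable (fun x => G x * max (f x) 0) μ := by
  rw [integrable_withDensity_iff_integrable_smul₀' hf.ennreal_ofReal (by simp)]
  simp only [ENNReal.toReal_ofReal', smul_eq_mul, mul_comm]

theorem ae_eq_zero_of_withDensity_ofReal_eq {Ω : Type*} [MeasurableSpace Ω] {μ : Measure Ω}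
    {f : Ω → ℝ} (hf : Integrable f μ)
    (h : μ.withDensity (fun x => ENNReal.ofReal (f x)) =
      μ.withDensity fun x => ENNReal.ofReal (-f x)) : f =ᵐ[μ] 0 := by
  have densities_eq := (withDensity_eq_iff hf.aemeasurable.ennreal_ofReal
    hf.neg.aemeasurable.ennreal_ofReal hf.lintegral_lt_top.ne).1 h
  filter_upwards [densities_eq] with x hx
  have max_eq : max (f x) 0 = max (-f x) 0 := by
    simpa only [ENNReal.toReal_ofReal', Pi.neg_apply] using congrArg ENNReal.toReal hx
  rw [Pi.zero_apply, ← max_zero_sub_max_neg_zero_eq_self (f x), max_eq, sub_self]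

variable {V : Type*} [AddCommGroup V] [Module ℝ V] {ν : Measure (Module.Dual ℝ V)}

theorem ae_eq_zero_of_integral_exp_mul_eq_zero_of_real {f : Module.Dual ℝ V → ℝ}
    (hf : ∀ v, Integrable (fun φ => Real.exp (φ v) * f φ) ν)
    (h : ∀ v, ∫ φ, Real.exp (φ v) * f φ ∂ν = 0) : f =ᵐ[ν] 0 := by
  have integrable_f : Integrable f ν := by simpa using hf 0
  have integrable_pos (v : V) : Integrable (fun φ => Real.exp (φ v) * max (f φ) 0) ν := by
    simpa only [mul_max_of_nonneg _ _ (Real.exp_pos _).le, mul_zero] using (hf v).pos_part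
  have integrable_neg (v : V) : Integrable (fun φ => Real.exp (φ v) * max (-f φ) 0) ν := by
    simpa only [mul_max_of_nonneg _ _ (Real.exp_pos _).le, mul_zero, mul_neg] using (hf v).neg_part
  have := isFiniteMeasure_withDensity_ofReal integrable_f.2
  have := isFiniteMeasure_withDensity_ofReal integrable_f.neg.2
  refine ae_eq_zero_of_withDensity_ofReal_eq integrable_f
    (algDual_measure_ext_of_integral_exp (fun v => ?_) fun v => ?_)
  · exact (integrable_withDensity_ofReal_iff integrable_f.aemeasurable).2 (integrable_pos v)
  · rw [integral_withDensity_ofReal integrable_f.aemeasurable,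
      integral_withDensity_ofReal (f := fun φ => -f φ) integrable_f.neg.aemeasurable,
      ← sub_eq_zero]
    refine (integral_sub (integrable_pos v) (integrable_neg v)).symm.trans ?_
    simpa only [← mul_sub, max_zero_sub_max_neg_zero_eq_self] using h v

theorem ae_eq_zero_of_integral_exp_mul_eq_zero {f : Module.Dual ℝ V → ℂ}
    (hf : ∀ v, Integrable (fun φ => (Real.exp (φ v) : ℂ) * f φ) ν)
    (h : ∀ v, ∫ φ, (Real.exp (φ v) : ℂ) * f φ ∂ν = 0) : f =ᵐ[ν] 0 := by
  have re_eq : (fun φ => (f φ).re) =ᵐ[ν] 0 :=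
    ae_eq_zero_of_integral_exp_mul_eq_zero_of_real
      (fun v => by
        simpa only [RCLike.re_to_complex, Complex.re_ofReal_mul] using (hf v).re) fun v => by
        have := integral_re (𝕜 := ℂ) (hf v)
        rw [h v] at this
        simpa only [RCLike.re_to_complex, Complex.re_ofReal_mul, Complex.zero_re] using this
  have im_eq : (fun φ => (f φ).im) =ᵐ[ν] 0 :=
    ae_eq_zero_of_integral_exp_mul_eq_zero_of_real
      (fun v => by
        simpa only [RCLike.im_to_complex, Complex.im_ofReal_mul] using (hf v).im) fun v => by
        have := integral_im (𝕜 := ℂ) (hf v)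
        rw [h v] at this
        simpa only [RCLike.im_to_complex, Complex.im_ofReal_mul, Complex.zero_im] using this
  filter_upwards [re_eq, im_eq] with φ hre him
  exact Complex.ext hre him

end TotalExponentials

/-! ### Gaussian measures on algebraic duals -/

/-- `ν` is a centered Gaussian measure on the algebraic dual of `V` with covariance
`c * ⟪r v, r w⟫`. The constant `c` is kept apart from `r` so that the two normalizations `½` and
`1` used for `νQ` and `νL` are instances. -/
def IsAlgDualGaussian {V H : Type*} [AddCommGroup V] [Module ℝ V] [NormedAddCommGroup H]
    [InnerProductSpace ℝ H] (r : V →ₗ[ℝ] H) (c : ℝ≥0) (ν : Measure (Module.Dual ℝ V)) : Prop :=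
  ∀ v : V, ν.map (fun φ => φ v) = gaussianReal 0 (c * ‖r v‖₊ ^ 2)

/-- The Cameron–Martin vector `w ↦ c * ⟪r v, r w⟫` associated to `v`: the covariance of the
evaluation at `v` with the other evaluations. Translations by these vectors preserve the class of
the Gaussian measure. -/
def cameronMartin {V H : Type*} [AddCommGroup V] [Module ℝ V] [NormedAddCommGroup H]
    [InnerProductSpace ℝ H] (r : V →ₗ[ℝ] H) (c : ℝ≥0) : V →ₗ[ℝ] Module.Dual ℝ V :=
  (c : ℝ) • (innerₗ H).compl₁₂ r r

theorem cameronMartin_apply {V H : Type*} [AddCommGroup V] [Module ℝ V] [NormedAddCommGroup H]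
    [InnerProductSpace ℝ H] (r : V →ₗ[ℝ] H) (c : ℝ≥0) (v w : V) :
    cameronMartin r c v w = c * ⟪r v, r w⟫_ℝ := by
  simp [cameronMartin]

/-- `f` has finite moments of all orders. -/
def HasAllMoments {Ω E : Type*} [MeasurableSpace Ω] [NormedAddCommGroup E] (f : Ω → E)
    (ν : Measure Ω) : Prop :=
  ∀ p : ℝ≥0∞, p ≠ ∞ → MemLp f p ν

namespace HasAllMoments

variable {Ω E : Type*} [MeasurableSpace Ω] {ν : Measure Ω}

section NormedAddCommGroup

variable [NormedAddCommGroup E] {f g : Ω → E}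

theorem const [IsFiniteMeasure ν] (z : E) : HasAllMoments (fun _ => z) ν :=
  fun _ _ => memLp_const z

theorem add (hf : HasAllMoments f ν) (hg : HasAllMoments g ν) :
    HasAllMoments (f + g) ν := fun p hp => (hf p hp).add (hg p hp)

theorem norm (hf : HasAllMoments f ν) : HasAllMoments (fun x => ‖f x‖) ν :=
  fun p hp => (hf p hp).norm

theorem ofReal {f : Ω → ℝ} (hf : HasAllMoments f ν) : HasAllMoments (fun x => (f x : ℂ)) ν :=
  fun p hp => (hf p hp).ofReal

theorem memLp_two (hf : HasAllMoments f ν) : MemLp f 2 ν := hf 2 (by norm_num)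

theorem integrable (hf : HasAllMoments f ν) : Integrable f ν :=
  memLp_one_iff_integrable.1 (hf 1 (by norm_num))

end NormedAddCommGroup

theorem mul [NormedRing E] {f g : Ω → E} (hf : HasAllMoments f ν) (hg : HasAllMoments g ν) :
    HasAllMoments (f * g) ν := fun p hp => by
  have h2 : 2 * p ≠ ∞ := ENNReal.mul_ne_top (by norm_num) hp
  have : ENNReal.HolderTriple (2 * p) (2 * p) p := ⟨by
    rw [ENNReal.mul_inv (Or.inl (by norm_num)) (Or.inl (by norm_num)), ← add_mul,
      ENNReal.inv_two_add_inv_two, one_mul]⟩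
  exact (hg _ h2).mul (hf _ h2)

end HasAllMoments

section ComplexEval

variable {V : Type*} [AddCommGroup V] [Module ℝ V]

/-- The evaluation `φ ↦ φ a + i φ b` at the formal complex combination `a + i b` of elements
of `V`. -/
def cEval (a b : V) : Module.Dual ℝ V →ₗ[ℝ] ℂ where
  toFun φ := φ a + Complex.I * φ b
  map_add' φ φ' := by
    simp only [LinearMap.add_apply, Complex.ofReal_add]
    ring
  map_smul' s φ := by
    simp only [LinearMap.smul_apply, smul_eq_mul, Complex.ofReal_mul, RingHom.id_apply,
      Complex.real_smul]
    ring

theorem cEval_apply (a b : V) (φ : Module.Dual ℝ V) : cEval a b φ = φ a + Complex.I * φ b := rfl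

theorem cEval_zero_right (a : V) (φ : Module.Dual ℝ V) : cEval a 0 φ = φ a := by
  simp [cEval_apply]

theorem cEval_smul (s : ℝ) (a b : V) : cEval (s • a) (s • b) = s • cEval a b := by
  ext φ
  simp only [cEval_apply, map_smul, smul_eq_mul, Complex.ofReal_mul, LinearMap.smul_apply,
    Complex.real_smul]
  ring

theorem conj_cEval (a b : V) (φ : Module.Dual ℝ V) :
    starRingEnd ℂ (cEval a b φ) = cEval a (-b) φ := by
  simp [cEval_apply]

theorem re_cEval (a b : V) (φ : Module.Dual ℝ V) : (cEval a b φ).re = φ a := by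
  simp [cEval_apply]

theorem norm_exp_cEval (a b : V) (φ : Module.Dual ℝ V) :
    ‖Complex.exp (cEval a b φ)‖ = Real.exp (φ a) := by
  rw [Complex.norm_exp, re_cEval]

theorem norm_exp_smul_cEval_le (a b : V) {s : ℝ} (hs : |s| < 1) (φ : Module.Dual ℝ V) :
    ‖Complex.exp (s * cEval a b φ)‖ ≤ Real.exp (φ a) + Real.exp (φ (-a)) := by
  rw [Complex.norm_exp, Complex.re_ofReal_mul, re_cEval, map_neg]
  obtain ⟨hs₁, hs₂⟩ := abs_lt.1 hs
  rcases le_total 0 (φ a) with h0 | h0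
  · exact (Real.exp_le_exp.2 (by nlinarith)).trans (le_add_of_nonneg_right (Real.exp_pos _).le)
  · exact (Real.exp_le_exp.2 (by nlinarith)).trans (le_add_of_nonneg_left (Real.exp_pos _).le)

theorem measurable_cEval (a b : V) : Measurable (cEval a b) :=
  (Complex.measurable_ofReal.comp (measurable_algDual_eval a)).add
    ((Complex.measurable_ofReal.comp (measurable_algDual_eval b)).const_mul _)

theorem hasLineDerivAt_cEval (a b : V) (φ h : Module.Dual ℝ V) :
    HasLineDerivAt ℝ (cEval a b) (cEval a b h) φ h := by
  simpa [HasLineDerivAt] using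
    ((hasDerivAt_id (0 : ℝ)).ofReal_comp.mul_const (cEval a b h)).const_add (cEval a b φ)

theorem hasLineDerivAt_exp_cEval (a b : V) (φ h : Module.Dual ℝ V) :
    HasLineDerivAt ℝ (fun φ => Complex.exp (cEval a b φ))
      (cEval a b h * Complex.exp (cEval a b φ)) φ h := by
  simpa [HasLineDerivAt, mul_comm] using (hasLineDerivAt_cEval a b φ h).cexp

/-- The algebra of functions on an algebraic dual generated by the complex evaluations and their
exponentials: it contains the coherent states, is stable under directional derivatives, and consists
of functions with all moments under Gaussian measures. -/
def polyExp (V : Type*) [AddCommGroup V] [Module ℝ V] : Subalgebra ℂ (Module.Dual ℝ V → ℂ) :=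
  Algebra.adjoin ℂ (Set.range (fun p : V × V => ⇑(cEval p.1 p.2)) ∪
    Set.range fun (p : V × V) φ => Complex.exp (cEval p.1 p.2 φ))

theorem cEval_mem_polyExp (a b : V) : ⇑(cEval a b) ∈ polyExp V :=
  Algebra.subset_adjoin (.inl ⟨(a, b), rfl⟩)

theorem exp_cEval_mem_polyExp (a b : V) : (fun φ => Complex.exp (cEval a b φ)) ∈ polyExp V :=
  Algebra.subset_adjoin (.inr ⟨(a, b), rfl⟩)

theorem measurable_of_mem_polyExp {f : Module.Dual ℝ V → ℂ} (hf : f ∈ polyExp V) :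
    Measurable f := by
  induction hf using Algebra.adjoin_induction with
  | mem f hf =>
    obtain ⟨⟨a, b⟩, rfl⟩ | ⟨⟨a, b⟩, rfl⟩ := hf
    · exact measurable_cEval a b
    · exact Complex.measurable_exp.comp (measurable_cEval a b)
  | algebraMap z => exact measurable_const
  | add f g _ _ hf hg => exact hf.add hg
  | mul f g _ _ hf hg => exact hf.mul hg

theorem exists_hasLineDerivAt_of_mem_polyExp {f : Module.Dual ℝ V → ℂ} (hf : f ∈ polyExp V)
    (h : Module.Dual ℝ V) : ∃ f' ∈ polyExp V, ∀ φ, HasLineDerivAt ℝ f (f' φ) φ h := by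
  induction hf using Algebra.adjoin_induction with
  | mem f hf =>
    obtain ⟨⟨a, b⟩, rfl⟩ | ⟨⟨a, b⟩, rfl⟩ := hf
    · exact ⟨_, (polyExp V).algebraMap_mem (cEval a b h), (hasLineDerivAt_cEval a b · h)⟩
    · exact ⟨_, mul_mem ((polyExp V).algebraMap_mem (cEval a b h)) (exp_cEval_mem_polyExp a b),
        (hasLineDerivAt_exp_cEval a b · h)⟩
  | algebraMap z => exact ⟨0, zero_mem _, fun _ => hasDerivAt_const 0 z⟩
  | add f g _ _ ihf ihg =>
    obtain ⟨f', hf'_mem, hf'⟩ := ihf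
    obtain ⟨g', hg'_mem, hg'⟩ := ihg
    exact ⟨f' + g', add_mem hf'_mem hg'_mem, fun φ => HasDerivAt.add (hf' φ) (hg' φ)⟩
  | mul f g hf hg ihf ihg =>
    obtain ⟨f', hf'_mem, hf'⟩ := ihf
    obtain ⟨g', hg'_mem, hg'⟩ := ihg
    exact ⟨f' * g + f * g', add_mem (mul_mem hf'_mem hg) (mul_mem hf hg'_mem), fun φ => by
      simpa only [HasLineDerivAt, Pi.add_apply, Pi.mul_apply, zero_smul, add_zero] using
        HasDerivAt.fun_mul (hf' φ) (hg' φ)⟩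

theorem lineDifferentiableAt_of_mem_polyExp {f : Module.Dual ℝ V → ℂ} (hf : f ∈ polyExp V)
    (φ h : Module.Dual ℝ V) : LineDifferentiableAt ℝ f φ h := by
  obtain ⟨f', -, hf'⟩ := exists_hasLineDerivAt_of_mem_polyExp hf h
  exact (hf' φ).lineDifferentiableAt

theorem lineDeriv_mem_polyExp {f : Module.Dual ℝ V → ℂ} (hf : f ∈ polyExp V)
    (h : Module.Dual ℝ V) : (fun φ => lineDeriv ℝ f φ h) ∈ polyExp V := by
  obtain ⟨f', hf'_mem, hf'⟩ := exists_hasLineDerivAt_of_mem_polyExp hf h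
  rwa [funext fun φ => (hf' φ).lineDeriv]

end ComplexEval

namespace IsAlgDualGaussian

variable {V H : Type*} [AddCommGroup V] [Module ℝ V] [NormedAddCommGroup H]
    [InnerProductSpace ℝ H] {r : V →ₗ[ℝ] H} {c : ℝ≥0} {ν : Measure (Module.Dual ℝ V)}

theorem isProbabilityMeasure (hν : IsAlgDualGaussian r c ν) : IsProbabilityMeasure ν := by
  have mass_eq : ν.map (fun φ => φ 0) Set.univ = 1 := by rw [hν 0]; exact measure_univ
  rw [Measure.map_apply (measurable_algDual_eval _) MeasurableSet.univ] at mass_eq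
  exact ⟨by simpa using mass_eq⟩

theorem hasAllMoments_eval (hν : IsAlgDualGaussian r c ν) (v : V) :
    HasAllMoments (fun φ => φ v) ν := fun p hp => by
  have memLp_id := memLp_id_gaussianReal' (μ := 0) (v := c * ‖r v‖₊ ^ 2) p hp
  rw [← hν v] at memLp_id
  exact memLp_id.comp_of_map (measurable_algDual_eval v).aemeasurable

theorem integrable_exp (hν : IsAlgDualGaussian r c ν) (v : V) :
    Integrable (fun φ => Real.exp (φ v)) ν := by
  have h := integrable_exp_mul_gaussianReal (μ := 0) (v := c * ‖r v‖₊ ^ 2) 1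
  rw [← hν v, integrable_map_measure (by fun_prop) (measurable_algDual_eval v).aemeasurable] at h
  simpa [Function.comp_def] using h

theorem integral_exp (hν : IsAlgDualGaussian r c ν) (v : V) :
    ∫ φ, Real.exp (φ v) ∂ν = Real.exp (c * ‖r v‖ ^ 2 / 2) := by
  simpa [mgf] using mgf_gaussianReal (hν v) 1

theorem hasAllMoments_exp (hν : IsAlgDualGaussian r c ν) (v : V) :
    HasAllMoments (fun φ => Real.exp (φ v)) ν := fun p hp => by
  have meas : AEStronglyMeasurable (fun φ : Module.Dual ℝ V => Real.exp (φ v)) ν :=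
    (Real.measurable_exp.comp (measurable_algDual_eval v)).aestronglyMeasurable
  rcases eq_or_ne p 0 with rfl | h0
  · simpa using meas
  rw [← integrable_norm_rpow_iff meas h0 hp]
  refine (hν.integrable_exp (p.toReal • v)).congr (.of_forall fun φ => ?_)
  simp [← Real.exp_mul, mul_comm]

theorem hasAllMoments_of_mem_polyExp (hν : IsAlgDualGaussian r c ν) {f : Module.Dual ℝ V → ℂ}
    (hf : f ∈ polyExp V) : HasAllMoments f ν := by
  have := hν.isProbabilityMeasure
  induction hf using Algebra.adjoin_induction with
  | mem f hf =>
    obtain ⟨⟨a, b⟩, rfl⟩ | ⟨⟨a, b⟩, rfl⟩ := hf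
    · exact (hν.hasAllMoments_eval a).ofReal.add
        ((HasAllMoments.const Complex.I).mul (hν.hasAllMoments_eval b).ofReal)
    · refine fun p hp => (hν.hasAllMoments_exp a p hp).of_le
        (measurable_of_mem_polyExp (exp_cEval_mem_polyExp a b)).aestronglyMeasurable
        (.of_forall fun φ => ?_)
      rw [norm_exp_cEval, Real.norm_of_nonneg (Real.exp_pos _).le]
  | algebraMap z => exact .const z
  | add f g _ _ hf hg => exact hf.add hg
  | mul f g _ _ hf hg => exact hf.mul hg

/-! ### Translations and integration by parts -/

theorem map_algDualShift (hν : IsAlgDualGaussian r c ν) (v : V) :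
    ν.map (algDualShift (cameronMartin r c v)) = ν.tilted fun φ => φ v := by
  have := hν.isProbabilityMeasure
  have := isProbabilityMeasure_tilted (hν.integrable_exp v)
  have : IsProbabilityMeasure (ν.map (algDualShift (cameronMartin r c v))) :=
    Measure.isProbabilityMeasure_map (algDualShift _).measurable.aemeasurable
  refine algDual_measure_ext_of_integral_exp (fun w => ?_) (fun w => ?_)
  · rw [integrable_map_equiv]
    simpa [Function.comp_def, algDualShift_apply, Real.exp_add] using
      (hν.integrable_exp w).mul_const _
  · rw [integral_map_equiv, integral_exp_tilted]
    simp only [Pi.add_apply, ← map_add, hν.integral_exp]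
    simp only [algDualShift_apply, LinearMap.add_apply, Real.exp_add, integral_mul_const,
      hν.integral_exp, cameronMartin_apply]
    rw [← Real.exp_add, ← Real.exp_sub, map_add, norm_add_sq_real]
    ring_nf

theorem integral_comp_add_cameronMartin (hν : IsAlgDualGaussian r c ν) (v : V)
    (G : Module.Dual ℝ V → ℂ) :
    ∫ φ, G (φ + cameronMartin r c v) ∂ν =
      ∫ φ, (Real.exp (φ v - c * ‖r v‖ ^ 2 / 2) : ℂ) * G φ ∂ν := by
  have h := integral_map_equiv (μ := ν) (algDualShift (cameronMartin r c v)) G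
  rw [hν.map_algDualShift, integral_tilted] at h
  simpa only [algDualShift_apply, hν.integral_exp, Complex.real_smul, ← Real.exp_sub] using h.symm

theorem integrable_comp_add_cameronMartin_iff (hν : IsAlgDualGaussian r c ν) (v : V)
    (G : Module.Dual ℝ V → ℂ) :
    Integrable (fun φ => G (φ + cameronMartin r c v)) ν ↔
      Integrable (fun φ => (Real.exp (φ v) : ℂ) * G φ) ν := by
  have h := integrable_map_equiv (μ := ν) (algDualShift (cameronMartin r c v)) G
  rw [hν.map_algDualShift, integrable_tilted_iff (hν.integrable_exp v)] at h
  exact h.symm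

theorem integral_exp_cEval (hν : IsAlgDualGaussian r c ν) (a b : V) :
    ∫ φ, Complex.exp (cEval a b φ) ∂ν =
      Complex.exp (c / 2 * (‖r a‖ ^ 2 - ‖r b‖ ^ 2) + Complex.I * (c * ⟪r a, r b⟫_ℝ)) := by
  have shift := hν.integral_comp_add_cameronMartin a fun φ => Complex.exp (Complex.I * φ b)
  have charFun_b := complexMGF_gaussianReal (hν b) Complex.I
  rw [complexMGF] at charFun_b
  simp only [LinearMap.add_apply, Complex.ofReal_add, mul_add, Complex.exp_add,
    cameronMartin_apply, integral_mul_const, charFun_b] at shift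
  have density_mul (φ : Module.Dual ℝ V) :
      (Real.exp (φ a - c * ‖r a‖ ^ 2 / 2) : ℂ) * Complex.exp (Complex.I * φ b) =
        Complex.exp (-(c * ‖r a‖ ^ 2 / 2)) * Complex.exp (cEval a b φ) := by
    rw [cEval_apply, Complex.ofReal_exp, ← Complex.exp_add, ← Complex.exp_add]
    push_cast
    ring_nf
  simp only [density_mul, integral_const_mul] at shift
  rw [← mul_right_inj' (Complex.exp_ne_zero (-(c * ‖r a‖ ^ 2 / 2))), ← shift, ← Complex.exp_add,
    ← Complex.exp_add, ← Complex.exp_add]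
  congr 1
  push_cast
  rw [Complex.I_sq]
  ring

theorem hasDerivAt_integral_exp_smul_cEval (hν : IsAlgDualGaussian r c ν)
    {f : Module.Dual ℝ V → ℂ} (hfm : AEStronglyMeasurable f ν)
    (hf : ∀ g : Module.Dual ℝ V → ℝ, HasAllMoments g ν → Integrable (fun φ => g φ * ‖f φ‖) ν)
    (a b : V) :
    HasDerivAt (fun s : ℝ => ∫ φ, Complex.exp (s * cEval a b φ) * f φ ∂ν)
      (∫ φ, cEval a b φ * f φ ∂ν) 0 := by
  have := hν.isProbabilityMeasure
  have meas (s : ℝ) : AEStronglyMeasurable (fun φ => Complex.exp (s * cEval a b φ) * f φ) ν :=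
    (Complex.measurable_exp.comp
      ((measurable_cEval a b).const_mul (s : ℂ))).aestronglyMeasurable.mul hfm
  have integrable_f : Integrable f ν :=
    (integrable_norm_iff hfm).1 (by simpa using hf _ (HasAllMoments.const 1))
  have bound_integrable : Integrable
      (fun φ => ‖cEval a b φ‖ * (Real.exp (φ a) + Real.exp (φ (-a))) * ‖f φ‖) ν :=
    hf _ ((hν.hasAllMoments_of_mem_polyExp (cEval_mem_polyExp a b)).norm.mul
      ((hν.hasAllMoments_exp a).add (hν.hasAllMoments_exp (-a))))
  have key := hasDerivAt_integral_of_dominated_loc_of_deriv_le (μ := ν) (x₀ := (0 : ℝ))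
    (F := fun (s : ℝ) φ => Complex.exp (s * cEval a b φ) * f φ)
    (F' := fun (s : ℝ) φ => cEval a b φ * (Complex.exp (s * cEval a b φ) * f φ))
    (Metric.ball_mem_nhds (0 : ℝ) one_pos) (.of_forall meas) (by simpa using integrable_f)
    ((measurable_cEval a b).aestronglyMeasurable.mul (meas 0))
    (.of_forall fun φ s hs => ?_) bound_integrable (.of_forall fun φ s _ => ?_)
  · simpa using key.2
  · rw [norm_mul, norm_mul, ← mul_assoc]
    gcongr
    exact norm_exp_smul_cEval_le a b (by simpa using hs) φ
  · have linear : HasDerivAt (fun s : ℝ => (s : ℂ) * cEval a b φ) (cEval a b φ) s := by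
      simpa using (hasDerivAt_id s).ofReal_comp.mul_const (cEval a b φ)
    exact (linear.cexp.mul_const (f φ)).congr_deriv (by ring)

theorem exists_local_bound_of_mem_polyExp (hν : IsAlgDualGaussian r c ν)
    {f : Module.Dual ℝ V → ℂ} (hf : f ∈ polyExp V) (h : Module.Dual ℝ V) :
    ∃ g : Module.Dual ℝ V → ℝ, HasAllMoments g ν ∧
      ∀ φ, ∀ t : ℝ, |t| < 1 → ‖f (φ + t • h)‖ ≤ g φ := by
  have := hν.isProbabilityMeasure
  induction hf using Algebra.adjoin_induction with
  | mem f hf =>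
    obtain ⟨⟨a, b⟩, rfl⟩ | ⟨⟨a, b⟩, rfl⟩ := hf
    · refine ⟨_, (hν.hasAllMoments_of_mem_polyExp (cEval_mem_polyExp a b)).norm.add
        (.const ‖cEval a b h‖), fun φ t ht => ?_⟩
      simp only [map_add, map_smul]
      refine (norm_add_le _ _).trans (add_le_add_right ?_ _)
      rw [norm_smul, Real.norm_eq_abs]
      exact mul_le_of_le_one_left (norm_nonneg _) ht.le
    · refine ⟨_, (hν.hasAllMoments_exp a).mul (.const (Real.exp |h a|)), fun φ t ht => ?_⟩
      rw [norm_exp_cEval, Pi.mul_apply, ← Real.exp_add, LinearMap.add_apply, LinearMap.smul_apply,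
        smul_eq_mul]
      gcongr
      calc t * h a ≤ |t| * |h a| := (le_abs_self _).trans (abs_mul t (h a)).le
        _ ≤ |h a| := mul_le_of_le_one_left (abs_nonneg _) ht.le
  | algebraMap z => exact ⟨_, .const ‖z‖, fun _ _ _ => le_rfl⟩
  | add f₁ f₂ _ _ ih₁ ih₂ =>
    obtain ⟨g₁, hg₁, h₁⟩ := ih₁
    obtain ⟨g₂, hg₂, h₂⟩ := ih₂
    exact ⟨_, hg₁.add hg₂, fun φ t ht =>
      (norm_add_le _ _).trans (add_le_add (h₁ φ t ht) (h₂ φ t ht))⟩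
  | mul f₁ f₂ _ _ ih₁ ih₂ =>
    obtain ⟨g₁, hg₁, h₁⟩ := ih₁
    obtain ⟨g₂, hg₂, h₂⟩ := ih₂
    exact ⟨_, hg₁.mul hg₂, fun φ t ht => (norm_mul_le _ _).trans (mul_le_mul (h₁ φ t ht)
      (h₂ φ t ht) (norm_nonneg _) ((norm_nonneg _).trans (h₁ φ t ht)))⟩

theorem hasDerivAt_integral_comp_add_smul (hν : IsAlgDualGaussian r c ν)
    {f : Module.Dual ℝ V → ℂ} (hf : f ∈ polyExp V) (h : Module.Dual ℝ V) :
    HasDerivAt (fun t : ℝ => ∫ φ, f (φ + t • h) ∂ν) (∫ φ, lineDeriv ℝ f φ h ∂ν) 0 := by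
  have meas {g : Module.Dual ℝ V → ℂ} (hg : g ∈ polyExp V) (t : ℝ) :
      AEStronglyMeasurable (fun φ => g (φ + t • h)) ν :=
    ((measurable_of_mem_polyExp hg).comp (algDualShift (t • h)).measurable).aestronglyMeasurable
  obtain ⟨g, hg, bound⟩ := hν.exists_local_bound_of_mem_polyExp (lineDeriv_mem_polyExp hf h) h
  have key := hasDerivAt_integral_of_dominated_loc_of_deriv_le (μ := ν) (x₀ := (0 : ℝ))
    (F := fun t φ => f (φ + t • h)) (F' := fun t φ => lineDeriv ℝ f (φ + t • h) h)
    (Metric.ball_mem_nhds (0 : ℝ) one_pos) (.of_forall (meas hf))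
    (by simpa using (hν.hasAllMoments_of_mem_polyExp hf).integrable)
    (meas (lineDeriv_mem_polyExp hf h) 0)
    (.of_forall fun φ t ht => bound φ t (by simpa using ht)) hg.integrable
    (.of_forall fun φ t _ => ?_)
  · simpa using key.2
  · have := (lineDifferentiableAt_of_mem_polyExp hf (φ + t • h) h).hasLineDerivAt
    rw [HasLineDerivAt, ← sub_self t] at this
    simpa [add_assoc, ← add_smul] using this.comp_sub_const t t

theorem integral_lineDeriv_cameronMartin (hν : IsAlgDualGaussian r c ν)
    {f : Module.Dual ℝ V → ℂ} (hf : f ∈ polyExp V) (v : V) :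
    ∫ φ, lineDeriv ℝ f φ (cameronMartin r c v) ∂ν = ∫ φ, φ v * f φ ∂ν := by
  have moments := hν.hasAllMoments_of_mem_polyExp hf
  have shift (t : ℝ) : ∫ φ, f (φ + t • cameronMartin r c v) ∂ν =
      Complex.exp (-(c * ‖r v‖ ^ 2 / 2 * t ^ 2 : ℝ)) *
        ∫ φ, Complex.exp (t * cEval v 0 φ) * f φ ∂ν := by
    rw [← map_smul, hν.integral_comp_add_cameronMartin, ← integral_const_mul]
    congr 1 with φ
    rw [← mul_assoc, ← Complex.exp_add, Complex.ofReal_exp, cEval_zero_right, map_smul, map_smul,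
      norm_smul, mul_pow, Real.norm_eq_abs, sq_abs]
    push_cast [smul_eq_mul]
    ring_nf
  have prefactor : HasDerivAt
      (fun t : ℝ => Complex.exp (-(c * ‖r v‖ ^ 2 / 2 * t ^ 2 : ℝ))) 0 0 := by
    have := (((hasDerivAt_id (0 : ℝ)).pow 2).const_mul (c * ‖r v‖ ^ 2 / 2)).neg.ofReal_comp.cexp
    simpa using this
  have rhs := prefactor.mul (hν.hasDerivAt_integral_exp_smul_cEval moments.memLp_two.1
    (fun g hg => (hg.mul moments.norm).integrable) v 0)
  have lhs := hν.hasDerivAt_integral_comp_add_smul hf (cameronMartin r c v)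
  rw [funext shift] at lhs
  simpa [cEval_zero_right] using lhs.unique rhs

end IsAlgDualGaussian

/-! ### Total families in Hilbert spaces -/

section TotalFamilies

variable {𝕜 Ω : Type*} [RCLike 𝕜] [MeasurableSpace Ω] {ν : Measure Ω}

theorem inner_toLp_left {f : Ω → 𝕜} (hf : MemLp f 2 ν) (g : Lp 𝕜 2 ν) :
    ⟪hf.toLp f, g⟫_𝕜 = ∫ x, starRingEnd 𝕜 (f x) * g x ∂ν := by
  rw [L2.inner_def]
  refine integral_congr_ae ?_
  filter_upwards [hf.coeFn_toLp] with x hx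
  rw [hx, RCLike.inner_apply, mul_comm]

theorem inner_toLp_toLp {f g : Ω → 𝕜} (hf : MemLp f 2 ν) (hg : MemLp g 2 ν) :
    ⟪hf.toLp f, hg.toLp g⟫_𝕜 = ∫ x, starRingEnd 𝕜 (f x) * g x ∂ν := by
  rw [inner_toLp_left]
  refine integral_congr_ae ?_
  filter_upwards [hg.coeFn_toLp] with x hx
  rw [hx]

variable {ι K K' : Type*} [NormedAddCommGroup K] [InnerProductSpace 𝕜 K]
  [NormedAddCommGroup K'] [InnerProductSpace 𝕜 K']

theorem denseRange_linearCombination_of_total [CompleteSpace K] {e : ι → K}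
    (he : ∀ x, (∀ i, ⟪e i, x⟫_𝕜 = 0) → x = 0) : DenseRange (Finsupp.linearCombination 𝕜 e) := by
  have hspan : (Submodule.span 𝕜 (Set.range e)).topologicalClosure = ⊤ := by
    rw [Submodule.topologicalClosure_eq_top_iff, Submodule.eq_bot_iff]
    exact fun x hx => he x fun i => hx _ (Submodule.subset_span ⟨i, rfl⟩)
  rw [← Finsupp.range_linearCombination] at hspan
  exact Submodule.dense_iff_topologicalClosure_eq_top.2 hspan

theorem norm_linearCombination_eq_of_inner_eq {e : ι → K} {e' : ι → K'}
    (h : ∀ i k, ⟪e i, e k⟫_𝕜 = ⟪e' i, e' k⟫_𝕜) (x : ι →₀ 𝕜) :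
    ‖Finsupp.linearCombination 𝕜 e x‖ = ‖Finsupp.linearCombination 𝕜 e' x‖ := by
  simp only [@norm_eq_sqrt_re_inner 𝕜, Finsupp.linearCombination_apply, Finsupp.sum, sum_inner,
    inner_sum, inner_smul_left, inner_smul_right, h]

theorem exists_linearIsometryEquiv_of_inner_eq [CompleteSpace K] [CompleteSpace K']
    {e : ι → K} {e' : ι → K'} (he : ∀ x, (∀ i, ⟪e i, x⟫_𝕜 = 0) → x = 0)
    (he' : ∀ x, (∀ i, ⟪e' i, x⟫_𝕜 = 0) → x = 0) (h : ∀ i k, ⟪e i, e k⟫_𝕜 = ⟪e' i, e' k⟫_𝕜) :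
    ∃ U : K ≃ₗᵢ[𝕜] K', ∀ i, U (e i) = e' i := by
  have hdense := denseRange_linearCombination_of_total he
  have hdense' := denseRange_linearCombination_of_total he'
  have hnorm (x : ι →₀ 𝕜) := (norm_linearCombination_eq_of_inner_eq h x).symm
  refine ⟨(LinearEquiv.refl 𝕜 (ι →₀ 𝕜)).extendOfIsometry _ _ hdense hdense' hnorm, fun i => ?_⟩
  simpa using LinearEquiv.extendOfIsometry_eq (LinearEquiv.refl 𝕜 (ι →₀ 𝕜)) _ _ hdense hdense'
    hnorm (Finsupp.single i 1)

end TotalFamilies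

/-! ### Mean values of entire functions -/

theorem integral_eq_apply_zero_of_circle_invariant {E F : Type*} [NormedAddCommGroup E]
    [NormedSpace ℂ E] [MeasurableSpace E] [BorelSpace E] [SecondCountableTopology E]
    [NormedAddCommGroup F] [NormedSpace ℂ F] [CompleteSpace F] {μ : Measure E}
    [IsProbabilityMeasure μ] (hμ : ∀ t : ℝ, μ.map (circleMap 0 1 t • ·) = μ) {p : E → F}
    (hp : Differentiable ℂ p) (hint : Integrable p μ) : ∫ z, p z ∂μ = p 0 := by
  have hrot : Measurable fun x : ℝ × E => circleMap 0 1 x.1 • x.2 := by fun_prop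
  have integral_rot (t : ℝ) : ∫ z, p (circleMap 0 1 t • z) ∂μ = ∫ z, p z ∂μ := by
    rw [← integral_map (φ := (circleMap 0 1 t • ·)) (by fun_prop)
      hp.continuous.aestronglyMeasurable, hμ]
  have : IsFiniteMeasure (volume.restrict (Set.uIoc 0 (2 * Real.pi))) :=
    inferInstanceAs (IsFiniteMeasure (volume.restrict (Set.Ioc _ _)))
  have hprod : Integrable (Function.uncurry fun t z => p (circleMap 0 1 t • z))
      ((volume.restrict (Set.uIoc 0 (2 * Real.pi))).prod μ) :=
    ((MeasurePreserving.id _).skew_product (g := fun t z => circleMap 0 1 t • z) hrot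
      (.of_forall hμ)).integrable_comp_of_integrable (hint.comp_snd _)
  calc ∫ z, p z ∂μ
      = Real.circleAverage (fun u => ∫ z, p (u • z) ∂μ) 0 1 := by
        simp only [Real.circleAverage, integral_rot, intervalIntegral.integral_const, sub_zero]
        rw [smul_smul, inv_mul_cancel₀ Real.two_pi_pos.ne', one_smul]
    _ = ∫ z, Real.circleAverage (fun u => p (u • z)) 0 1 ∂μ := by
        simp only [Real.circleAverage]
        rw [intervalIntegral_integral_swap hprod, integral_smul]
    _ = ∫ _, p 0 ∂μ := by
        refine integral_congr_ae (.of_forall fun z => ?_)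
        have hpz : Differentiable ℂ fun u : ℂ => p (u • z) := by fun_prop
        simpa using hpz.diffContOnCl.circleAverage (c := 0) (R := 1)
    _ = p 0 := by simp

theorem image_span_of_map_add_of_map_smul {R E F : Type*} [Semiring R] [AddCommMonoid E]
    [Module R E] [AddCommMonoid F] [Module R F] {V : Submodule R E} {f : E → F}
    (hadd : ∀ x ∈ V, ∀ y ∈ V, f (x + y) = f x + f y)
    (hsmul : ∀ (z : R), ∀ x ∈ V, f (z • x) = z • f x) {s : Set E} (hs : s ⊆ V) :
    f '' Submodule.span R s = Submodule.span R (f '' s) := by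
  let g : V →ₗ[R] F :=
    { toFun := fun x => f x
      map_add' := fun x y => hadd x x.2 y y.2
      map_smul' := fun z x => hsmul z x x.2 }
  obtain ⟨t, rfl⟩ : ∃ t : Set V, V.subtype '' t = s :=
    ⟨_, Subtype.image_preimage_coe _ _ |>.trans (Set.inter_eq_right.2 hs)⟩
  have image_span := congrArg SetLike.coe (Submodule.map_span g t)
  rw [Submodule.map_coe] at image_span
  rw [Submodule.span_image, Submodule.map_coe, Set.image_image, Set.image_image]
  exact image_span
/-! ### The Gaussian measure on the complexified phase space -/

section Riesz

variable {L : Type*} [NormedAddCommGroup L] [InnerProductSpace ℝ L] [CompleteSpace L]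

variable (L) in
/-- The Riesz representation of functionals, as a linear map: the covariance structure of
Gaussian measures on `Module.Dual ℝ (StrongDual ℝ L)`. -/
def riesz : StrongDual ℝ L →ₗ[ℝ] L := (InnerProductSpace.toDual ℝ L).symm.toLinearEquiv.toLinearMap

theorem inner_riesz (l : StrongDual ℝ L) (ξ : L) : ⟪riesz L l, ξ⟫_ℝ = l ξ :=
  InnerProductSpace.toDual_symm_apply

theorem riesz_innerSL (ξ : L) : riesz L (innerSL ℝ ξ) = ξ :=
  (InnerProductSpace.toDual ℝ L).symm_apply_apply ξ

theorem norm_riesz (l : StrongDual ℝ L) : ‖riesz L l‖ = ‖l‖ :=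
  (InnerProductSpace.toDual ℝ L).symm.norm_map l

theorem IsBidualGaussian.isAlgDualGaussian {c : ℝ≥0}
    {ν : Measure (Module.Dual ℝ (StrongDual ℝ L))} (hν : IsBidualGaussian c ν) :
    IsAlgDualGaussian (riesz L) c ν := fun l => by
  rw [hν l, show ‖riesz L l‖₊ = ‖l‖₊ from NNReal.eq (norm_riesz l)]

theorem bidualIncl_eq_cameronMartin (ξ : L) :
    bidualIncl L ξ = cameronMartin (riesz L) 1 (innerSL ℝ ξ) := by
  ext l
  rw [cameronMartin_apply, riesz_innerSL, real_inner_comm, inner_riesz, NNReal.coe_one, one_mul]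
  rfl

end Riesz

namespace AffineFieldTheory

variable {L : Type u} {A : Type*} [NormedAddCommGroup L] [InnerProductSpace ℝ L]
  [CompleteSpace L] [TopologicalSpace.SeparableSpace L] [MetricSpace A] [NormedAddTorsor L A]
  (T : AffineFieldTheory L A)

theorem ω_def (τ ξ : L) : T.ω τ ξ = 1 / 2 * T.br τ ξ - 1 / 2 * T.br ξ τ := rfl

theorem inner_J_right (τ ξ : L) : ⟪τ, T.J ξ⟫_ℝ = -(2 * T.ω τ ξ) := by
  rw [T.inner_eq, T.J_J]
  simp only [symplecticForm, map_neg, neg_apply]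
  ring

theorem inner_J_left (τ ξ : L) : ⟪T.J τ, ξ⟫_ℝ = 2 * T.ω τ ξ := by
  rw [real_inner_comm, inner_J_right, ω_def, ω_def]
  ring

theorem inner_J_J (τ ξ : L) : ⟪T.J τ, T.J ξ⟫_ℝ = ⟪τ, ξ⟫_ℝ := by
  rw [T.inner_J_left, T.inner_eq]

theorem inner_J_self (τ : L) : ⟪τ, T.J τ⟫_ℝ = 0 := by
  rw [T.inner_J_right, ω_def]
  ring

theorem norm_J (τ : L) : ‖T.J τ‖ = ‖τ‖ := by
  rw [norm_eq_sqrt_real_inner, norm_eq_sqrt_real_inner, T.inner_J_J]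

theorem isAlgDualGaussian_νL : IsAlgDualGaussian (riesz L) 1 T.νL := T.νL_spec.isAlgDualGaussian

instance isProbabilityMeasure_νL : IsProbabilityMeasure T.νL := T.νL_spec.isProbabilityMeasure

theorem hermHat_eq_cEval (τ : L) : T.hermHat τ = cEval (innerSL ℝ τ) (innerSL ℝ (T.J τ)) := by
  have hωL : innerSL ℝ (T.J τ) = (2 : ℝ) • T.ωL τ := by
    ext ξ
    simp only [innerSL_apply_apply, T.inner_J_left, ωL, symplecticForm, smul_apply, smul_eq_mul,
      sub_apply, ContinuousLinearMap.flip_apply]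
  ext φ
  rw [hermHat, cEval_apply, hωL, map_smul, smul_eq_mul]
  push_cast
  ring

theorem hermHat_add (τ : L) (φ φ' : T.LHat) :
    T.hermHat τ (φ + φ') = T.hermHat τ φ + T.hermHat τ φ' := by
  rw [T.hermHat_eq_cEval, map_add]

theorem measurable_hermHat (τ : L) : Measurable (T.hermHat τ) := by
  rw [T.hermHat_eq_cEval]
  exact measurable_cEval _ _

theorem conj_hermHat (τ : L) (φ : T.LHat) :
    starRingEnd ℂ (T.hermHat τ φ) = 2 * φ (innerSL ℝ τ) - T.hermHat τ φ := by
  rw [T.hermHat_eq_cEval, conj_cEval, cEval_apply, cEval_apply, map_neg]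
  push_cast
  ring

theorem hermHat_inclL_self (ξ : L) : T.hermHat ξ (T.inclL ξ) = (‖ξ‖ ^ 2 : ℝ) := by
  rw [T.hermHat_incl, herm, real_inner_self_eq_norm_sq, ω_def]
  simp

theorem coherentL_mem_polyExp (τ : L) : T.coherentL τ ∈ polyExp (StrongDual ℝ L) := by
  have hexp : T.coherentL τ = fun φ => Complex.exp
      (cEval ((1 / 2 : ℝ) • innerSL ℝ τ) ((1 / 2 : ℝ) • innerSL ℝ (T.J τ)) φ) := by
    ext φ
    rw [coherentL, T.hermHat_eq_cEval, cEval_smul, LinearMap.smul_apply, Complex.real_smul]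
    norm_num
  exact hexp ▸ exp_cEval_mem_polyExp _ _

theorem memLp_coherentL (τ : L) : MemLp (T.coherentL τ) 2 T.νL :=
  (T.isAlgDualGaussian_νL.hasAllMoments_of_mem_polyExp (T.coherentL_mem_polyExp τ)).memLp_two

theorem conj_coherentL (τ : L) (φ : T.LHat) : starRingEnd ℂ (T.coherentL τ φ) =
    Real.exp (φ (innerSL ℝ τ)) * Complex.exp (-1 / 2 * T.hermHat τ φ) := by
  rw [coherentL, ← Complex.exp_conj, map_mul, T.conj_hermHat, Complex.ofReal_exp, ← Complex.exp_add]
  simp only [map_div₀, map_one, map_ofNat]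
  ring_nf

/-! ### Rotation invariance and the mean value property -/

/-- The transpose of the phase rotation `exp (-t J)` of `L`; precomposition with it acts on `LHat`
as `exp (t J)` and multiplies the functionals `hermHat τ` by `exp (i t)`. -/
def rotation (t : ℝ) : StrongDual ℝ L →ₗ[ℝ] StrongDual ℝ L :=
  (InnerProductSpace.toDual ℝ L).toLinearEquiv.toLinearMap.comp
    ((Real.cos t • LinearMap.id - Real.sin t • T.J).comp (riesz L))

theorem rotation_innerSL (t : ℝ) (τ : L) : T.rotation t (innerSL ℝ τ) =
    Real.cos t • innerSL ℝ τ - Real.sin t • innerSL ℝ (T.J τ) := by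
  change innerSL ℝ (Real.cos t • riesz L (innerSL ℝ τ) -
    Real.sin t • T.J (riesz L (innerSL ℝ τ))) = _
  rw [riesz_innerSL]
  ext ξ
  simp

theorem norm_rotation (t : ℝ) (l : StrongDual ℝ L) : ‖T.rotation t l‖ = ‖l‖ := by
  change ‖innerSL ℝ (Real.cos t • riesz L l - Real.sin t • T.J (riesz L l))‖ = _
  rw [innerSL_apply_norm, ← norm_riesz l, ← sq_eq_sq₀ (norm_nonneg _) (norm_nonneg _),
    norm_sub_sq_real, norm_smul, norm_smul, T.norm_J, real_inner_smul_left, inner_smul_right,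
    T.inner_J_self, mul_pow, mul_pow, Real.norm_eq_abs, Real.norm_eq_abs, sq_abs, sq_abs]
  linear_combination ‖riesz L l‖ ^ 2 * Real.cos_sq_add_sin_sq t

theorem measurePreserving_comp_rotation (t : ℝ) :
    MeasurePreserving (fun φ : T.LHat => φ.comp (T.rotation t)) T.νL T.νL := by
  have hmeas : Measurable (fun φ : T.LHat => φ.comp (T.rotation t)) :=
    measurable_algDual_iff.2 fun l => measurable_algDual_eval (T.rotation t l)
  refine ⟨hmeas, IsBidualGaussian.unique (c := 1) (fun l => ?_) T.νL_spec⟩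
  rw [Measure.map_map (measurable_algDual_eval l) hmeas,
    show ‖l‖₊ = ‖T.rotation t l‖₊ from NNReal.eq (T.norm_rotation t l).symm]
  exact T.νL_spec (T.rotation t l)

theorem hermHat_comp_rotation (t : ℝ) (τ : L) (φ : T.LHat) :
    T.hermHat τ (φ.comp (T.rotation t)) = circleMap 0 1 t * T.hermHat τ φ := by
  simp only [circleMap, Complex.ofReal_one, one_mul, zero_add, T.hermHat_eq_cEval, cEval_apply,
    LinearMap.comp_apply, T.rotation_innerSL, T.J_J, map_sub, map_neg, map_smul, smul_eq_mul,
    Complex.exp_mul_I]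
  push_cast
  linear_combination (-(Complex.sin t * φ (innerSL ℝ (T.J τ)))) * Complex.I_sq

theorem map_circle_smul_map_hermHat {ι : Type*} (τ : ι → L) (t : ℝ) :
    (T.νL.map fun φ i => T.hermHat (τ i) φ).map (circleMap 0 1 t • ·) =
      T.νL.map fun φ i => T.hermHat (τ i) φ := by
  have hmeas : Measurable fun (φ : T.LHat) i => T.hermHat (τ i) φ :=
    measurable_pi_lambda _ fun i => T.measurable_hermHat _
  have hrot : (circleMap 0 1 t • ·) ∘ (fun (φ : T.LHat) i => T.hermHat (τ i) φ) =
      (fun φ i => T.hermHat (τ i) φ) ∘ fun φ => φ.comp (T.rotation t) := by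
    ext φ i
    exact (T.hermHat_comp_rotation t (τ i) φ).symm
  rw [Measure.map_map (by fun_prop) hmeas, hrot,
    ← Measure.map_map hmeas (T.measurePreserving_comp_rotation t).measurable,
    (T.measurePreserving_comp_rotation t).map_eq]

variable {T} in
theorem IsCylinderHolomorphic.integral_comp_add {f : T.LHat → ℂ} (hf : T.IsCylinderHolomorphic f)
    (h : T.LHat) (hint : Integrable (fun φ => f (φ + h)) T.νL) :
    ∫ φ, f (φ + h) ∂T.νL = f h := by
  obtain ⟨n, τ, p, hp, hfp⟩ := hf
  let Z : T.LHat → Fin n → ℂ := fun φ i => T.hermHat (τ i) φ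
  have hZ : Measurable Z := measurable_pi_lambda _ fun i => T.measurable_hermHat _
  have hp_shift : Differentiable ℂ fun z => p (z + Z h) := by fun_prop
  have hf_shift : (fun φ => f (φ + h)) = fun φ => p (Z φ + Z h) := by
    ext φ
    simp only [hfp, T.hermHat_add]
    rfl
  have := Measure.isProbabilityMeasure_map (μ := T.νL) hZ.aemeasurable
  rw [hf_shift] at hint ⊢
  rw [← integral_map (f := fun z => p (z + Z h)) hZ.aemeasurable
    hp_shift.continuous.aestronglyMeasurable, hfp h, ← zero_add fun i => T.hermHat (τ i) h]
  exact integral_eq_apply_zero_of_circle_invariant (T.map_circle_smul_map_hermHat τ) hp_shift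
    ((integrable_map_measure hp_shift.continuous.aestronglyMeasurable hZ.aemeasurable).2 hint)
/-! ### The reproducing property -/

section Cylinder

variable {T} {f : T.LHat → ℂ}

theorem IsCylinderHolomorphic.mul_exp (hf : T.IsCylinderHolomorphic f) (z : ℂ) (τ : L) :
    T.IsCylinderHolomorphic fun φ => f φ * Complex.exp (z * T.hermHat τ φ) := by
  obtain ⟨n, σ, p, hp, hfp⟩ := hf
  refine ⟨n + 1, Fin.cons τ σ, fun w => p (fun i => w i.succ) * Complex.exp (z * w 0), ?_, ?_⟩
  · fun_prop
  · simp [hfp]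

theorem IsCylinderHolomorphic.integral_exp_mul (hf : T.IsCylinderHolomorphic f) (ξ : L)
    (hint : Integrable (fun φ => (Real.exp (φ (innerSL ℝ ξ)) : ℂ) * f φ) T.νL) :
    ∫ φ, (Real.exp (φ (innerSL ℝ ξ) - ‖ξ‖ ^ 2 / 2) : ℂ) * f φ ∂T.νL = f (T.inclL ξ) := by
  have hν := T.isAlgDualGaussian_νL
  have hshift := hν.integral_comp_add_cameronMartin (innerSL ℝ ξ) f
  rw [← bidualIncl_eq_cameronMartin, riesz_innerSL, NNReal.coe_one, one_mul] at hshift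
  rw [← hshift]
  refine hf.integral_comp_add _ ?_
  rw [bidualIncl_eq_cameronMartin]
  exact (hν.integrable_comp_add_cameronMartin_iff _ f).2 hint

theorem IsCylinderHolomorphic.integral_conj_coherentL_mul (hf : T.IsCylinderHolomorphic f)
    (hf2 : MemLp f 2 T.νL) (ξ : L) :
    ∫ φ, starRingEnd ℂ (T.coherentL ξ φ) * f φ ∂T.νL = f (T.inclL ξ) := by
  have hconj (φ : T.LHat) : (Real.exp (φ (innerSL ℝ ξ)) : ℂ) *
      (f φ * Complex.exp (-1 / 2 * T.hermHat ξ φ)) = starRingEnd ℂ (T.coherentL ξ φ) * f φ := by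
    rw [T.conj_coherentL]
    ring
  have hint : Integrable (fun φ => starRingEnd ℂ (T.coherentL ξ φ) * f φ) T.νL :=
    (T.memLp_coherentL ξ).star.integrable_mul hf2
  have hrep := (hf.mul_exp (-1 / 2) ξ).integral_exp_mul ξ (by simpa only [hconj] using hint)
  simp only [sub_eq_add_neg, Real.exp_add, Complex.ofReal_mul, mul_right_comm _
    (Real.exp (-(‖ξ‖ ^ 2 / 2)) : ℂ), hconj, T.hermHat_inclL_self] at hrep
  have hexp : (Real.exp (-(‖ξ‖ ^ 2 / 2)) : ℂ) =
      Complex.exp (-1 / 2 * (‖ξ‖ ^ 2 : ℝ)) := by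
    push_cast
    ring_nf
  rw [integral_mul_const, hexp] at hrep
  exact mul_right_cancel₀ (Complex.exp_ne_zero _) hrep

end Cylinder

theorem isCylinderHolomorphic_coherentL (τ : L) : T.IsCylinderHolomorphic (T.coherentL τ) :=
  ⟨1, fun _ => τ, fun w => Complex.exp (1 / 2 * w 0), by fun_prop, fun _ => rfl⟩

theorem restrictL_eq_of_cylinder {p : T.LHat → ℂ} {f : T.H2} (hp : T.IsCylinderHolomorphic p)
    (hf : (f : Lp ℂ 2 T.νL) =ᵐ[T.νL] p) (ξ : L) : T.restrictL f ξ = p (T.inclL ξ) := by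
  rw [← hp.integral_conj_coherentL_mul ((memLp_congr_ae hf).1 (Lp.memLp _)) ξ]
  refine integral_congr_ae ?_
  filter_upwards [hf] with φ hφ
  rw [hφ]

theorem memLp_exp_innerSL (ξ : L) :
    MemLp (fun φ : T.LHat => (Real.exp (φ (innerSL ℝ ξ) - ‖ξ‖ ^ 2 / 2) : ℂ)) 2 T.νL := by
  simp only [sub_eq_add_neg, Real.exp_add]
  exact ((T.isAlgDualGaussian_νL.hasAllMoments_exp (innerSL ℝ ξ)).memLp_two.mul_const _).ofReal

/-- Both sides are continuous in `f`, and both are evaluation at `ξ` on cylinder functions. -/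
theorem integral_exp_mul_eq_restrictL (f : T.H2) (ξ : L) :
    ∫ φ, (Real.exp (φ (innerSL ℝ ξ) - ‖ξ‖ ^ 2 / 2) : ℂ) * (f : Lp ℂ 2 T.νL) φ ∂T.νL =
      T.restrictL f ξ := by
  let e : Lp ℂ 2 T.νL := (T.memLp_exp_innerSL ξ).toLp
  let k : Lp ℂ 2 T.νL := (T.memLp_coherentL ξ).toLp
  have hH2 : T.H2 ≤ (Submodule.span ℂ {e - k})ᗮ := by
    refine Submodule.topologicalClosure_minimal _ (Submodule.span_le.2 ?_)
      (Submodule.isClosed_orthogonal _)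
    rintro g ⟨p, hp, hgp⟩
    have hp2 := (memLp_congr_ae hgp).1 (Lp.memLp g)
    have hg : g = hp2.toLp p := Lp.ext (hgp.trans hp2.coeFn_toLp.symm)
    rw [SetLike.mem_coe, Submodule.mem_orthogonal_singleton_iff_inner_right, inner_sub_left,
      hg, inner_toLp_toLp, inner_toLp_toLp, hp.integral_conj_coherentL_mul hp2, sub_eq_zero]
    simp only [Complex.conj_ofReal]
    exact hp.integral_exp_mul ξ
      ((T.isAlgDualGaussian_νL.hasAllMoments_exp _).ofReal.memLp_two.integrable_mul hp2)
  have hf := Submodule.mem_orthogonal_singleton_iff_inner_right.1 (hH2 f.2)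
  rw [inner_sub_left, inner_toLp_left, inner_toLp_left, sub_eq_zero] at hf
  rw [restrictL, ← hf]
  simp only [Complex.conj_ofReal]

theorem eq_zero_of_restrictL_eq_zero {f : T.H2} (hf : ∀ ξ, T.restrictL f ξ = 0) : f = 0 := by
  refine Subtype.ext (Lp.eq_zero_iff_ae_eq_zero.2 ?_)
  have hν := T.isAlgDualGaussian_νL
  refine ae_eq_zero_of_integral_exp_mul_eq_zero
    (fun l => (hν.hasAllMoments_exp l).ofReal.memLp_two.integrable_mul (Lp.memLp _)) fun l => ?_
  obtain ⟨ξ, rfl⟩ := (InnerProductSpace.toDual ℝ L).surjective l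
  have hrestrict := T.integral_exp_mul_eq_restrictL f ξ
  simp only [sub_eq_add_neg, Real.exp_add, Complex.ofReal_mul,
    mul_right_comm _ (Real.exp (-(‖ξ‖ ^ 2 / 2)) : ℂ)] at hrestrict
  rw [integral_mul_const, hf] at hrestrict
  exact (mul_eq_zero.1 hrestrict).resolve_right (Complex.ofReal_ne_zero.2 (Real.exp_ne_zero _))

/-- The coherent state `coherentL τ` as an element of the Hilbert space `H2`. -/
def coherentH2 (τ : L) : T.H2 :=
  ⟨(T.memLp_coherentL τ).toLp (T.coherentL τ), Submodule.le_topologicalClosure _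
    (Submodule.subset_span ⟨_, T.isCylinderHolomorphic_coherentL τ, MemLp.coeFn_toLp _⟩)⟩

theorem inner_coherentH2 (ξ : L) (f : T.H2) : ⟪T.coherentH2 ξ, f⟫_ℂ = T.restrictL f ξ :=
  inner_toLp_left (T.memLp_coherentL ξ) (f : Lp ℂ 2 T.νL)

theorem restrictL_coherentH2 (τ ξ : L) :
    T.restrictL (T.coherentH2 τ) ξ = Complex.exp (1 / 2 * T.herm τ ξ) := by
  rw [T.restrictL_eq_of_cylinder (T.isCylinderHolomorphic_coherentL τ)
    (MemLp.coeFn_toLp (T.memLp_coherentL τ)), coherentL, T.hermHat_incl]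

/-! ### Wave functions on the affine space -/

theorem θ_eq_add_br (η ζ : A) (v : L) : T.θ ζ v = T.θ η v + T.br (ζ -ᵥ η) v := by
  rw [← T.θ_vadd, vsub_vadd]

theorem conj_α (η ζ : A) : starRingEnd ℂ (T.α ζ η) = T.α η ζ := by
  rw [α, α, ← Complex.exp_conj, ← neg_vsub_eq_vsub_rev ζ η]
  congr 1
  simp only [map_neg, inner_neg_neg, map_sub, map_add, map_mul, map_div₀, Complex.conj_I,
    Complex.conj_ofReal, map_one, map_ofNat]
  push_cast
  ring

theorem α_mul_exp_herm_mul_α (η ζ ζ' : A) :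
    T.α ζ η * Complex.exp (1 / 2 * T.herm (ζ -ᵥ η) (ζ' -ᵥ η)) * T.α η ζ' = T.α ζ ζ' := by
  simp only [α, ← Complex.exp_add]
  congr 1
  rw [← neg_vsub_eq_vsub_rev ζ η, ← vsub_sub_vsub_cancel_right ζ' ζ η, herm]
  simp only [T.θ_eq_add_br η ζ, T.θ_eq_add_br η ζ', ω_def, map_neg, map_sub, inner_neg_neg,
    inner_sub_left, inner_sub_right, real_inner_comm (ζ' -ᵥ η) (ζ -ᵥ η)]
  push_cast
  ring

/-- The holomorphic function that presents the affine coherent state of `ζ` relative to the base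
point `η`. -/
def coherentH2At (η ζ : A) : T.H2 := T.α ζ η • T.coherentH2 (ζ -ᵥ η)

theorem inner_coherentH2At (η ζ : A) (f : T.H2) :
    ⟪T.coherentH2At η ζ, f⟫_ℂ = T.waveH η f ζ := by
  rw [waveH, ← T.inner_coherentH2, ← T.conj_α η ζ, mul_comm]
  exact inner_smul_left (𝕜 := ℂ) (T.coherentH2 (ζ -ᵥ η)) f (T.α ζ η)

theorem waveH_smul (η : A) (z : ℂ) (f : T.H2) : T.waveH η (z • f) = z • T.waveH η f := by
  ext ζ
  rw [Pi.smul_apply, ← T.inner_coherentH2At, ← T.inner_coherentH2At, smul_eq_mul]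
  exact inner_smul_right (𝕜 := ℂ) (T.coherentH2At η ζ) f z

theorem waveH_coherentH2At (η ζ : A) : T.waveH η (T.coherentH2At η ζ) = T.coherentH ζ := by
  ext ζ'
  rw [coherentH2At, waveH_smul, Pi.smul_apply, waveH, T.restrictL_coherentH2, smul_eq_mul,
    ← mul_assoc, T.α_mul_exp_herm_mul_α, coherentH]

theorem inner_coherentH2At_coherentH2At (η ζ ζ' : A) :
    ⟪T.coherentH2At η ζ, T.coherentH2At η ζ'⟫_ℂ = T.α ζ' ζ := by
  rw [T.inner_coherentH2At, T.waveH_coherentH2At, coherentH]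

theorem eq_zero_of_inner_coherentH2At_eq_zero (η : A) (f : T.H2)
    (hf : ∀ ζ, ⟪T.coherentH2At η ζ, f⟫_ℂ = 0) : f = 0 := by
  refine T.eq_zero_of_restrictL_eq_zero fun ξ => ?_
  have hξ := hf (ξ +ᵥ η)
  rw [T.inner_coherentH2At, waveH, vadd_vsub] at hξ
  exact (mul_eq_zero.1 hξ).resolve_right (Complex.exp_ne_zero _)

instance completeSpace_H2 : CompleteSpace T.H2 :=
  (Submodule.isClosed_topologicalClosure _).completeSpace_coe

theorem waveH_injective (η : A) : Function.Injective (T.waveH η) := by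
  intro f f' h
  rw [← sub_eq_zero]
  refine T.eq_zero_of_inner_coherentH2At_eq_zero η _ fun ζ => ?_
  rw [inner_sub_right, T.inner_coherentH2At, T.inner_coherentH2At, h, sub_self]

theorem exists_waveH_change_base (η η' : A) : ∃ U : T.H2 ≃ₗᵢ[ℂ] T.H2,
    ∀ f, T.waveH η (U f) = T.waveH η' f := by
  obtain ⟨U, hU⟩ := exists_linearIsometryEquiv_of_inner_eq (𝕜 := ℂ)
    (e := T.coherentH2At η') (e' := T.coherentH2At η)
    (T.eq_zero_of_inner_coherentH2At_eq_zero η') (T.eq_zero_of_inner_coherentH2At_eq_zero η)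
    fun ζ ζ' => by rw [T.inner_coherentH2At_coherentH2At, T.inner_coherentH2At_coherentH2At]
  refine ⟨U, fun f => funext fun ζ => ?_⟩
  rw [← T.inner_coherentH2At, ← T.inner_coherentH2At, ← hU, U.inner_map_map]

theorem bijOn_waveH (η : A) : Set.BijOn (T.waveH η) Set.univ T.HHat := by
  refine ⟨fun f _ => ⟨η, f, rfl⟩, (T.waveH_injective η).injOn, ?_⟩
  rintro _ ⟨η', f, rfl⟩
  obtain ⟨U, hU⟩ := T.exists_waveH_change_base η η'
  exact ⟨U f, trivial, hU f⟩

theorem norm_eq_of_waveH_eq {η η' : A} {f f' : T.H2} (h : T.waveH η f = T.waveH η' f') :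
    ‖f‖ = ‖f'‖ := by
  obtain ⟨U, hU⟩ := T.exists_waveH_change_base η η'
  rw [← hU] at h
  rw [T.waveH_injective η h, U.norm_map]

/-! ### Linear algebra of the polarization -/

theorem brQ_q (ξ τ : L) : T.brQ ξ (T.q τ) = T.br ξ τ := rfl

theorem brQ_add (ξ τ : L) : T.brQ (ξ + τ) = T.brQ ξ + T.brQ τ := by
  ext φ
  obtain ⟨σ, rfl⟩ := T.M.mkQ_surjective φ
  change T.br (ξ + τ) σ = T.br ξ σ + T.br τ σ
  rw [map_add, add_apply]

theorem brQ_smul (s : ℝ) (ξ : L) : T.brQ (s • ξ) = s • T.brQ ξ := by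
  ext φ
  obtain ⟨σ, rfl⟩ := T.M.mkQ_surjective φ
  change T.br (s • ξ) σ = s • T.br ξ σ
  rw [map_smul, smul_apply]

theorem gQ_add (χ χ' : T.Q) : T.gQ (χ + χ') = T.gQ χ + T.gQ χ' := by
  simp only [gQ, map_add, ContinuousLinearMap.add_comp]

theorem gQ_smul (s : ℝ) (χ : T.Q) : T.gQ (s • χ) = s • T.gQ χ := by
  simp only [gQ, map_smul, ContinuousLinearMap.smul_comp]

theorem gQ_apply (χ χ' : T.Q) : T.gQ χ χ' = ⟪T.j χ, T.j χ'⟫_ℝ := rfl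

theorem j_mem_orthogonal (χ : T.Q) : T.j χ ∈ T.Mᗮ := T.map_J_le_orthogonal (T.j_mem χ)

/-- The component in `M` of a vector of `L = J M ⊕ M`. -/
def momentumPart : L →ₗ[ℝ] L := LinearMap.id - T.j.toLinearMap ∘ₗ T.q.toLinearMap

theorem j_q_add_momentumPart (ξ : L) : T.j (T.q ξ) + T.momentumPart ξ = ξ :=
  add_sub_cancel _ _

theorem momentumPart_mem (ξ : L) : T.momentumPart ξ ∈ T.M := by
  rw [← Submodule.Quotient.mk_eq_zero, ← Submodule.mkQ_apply, ← T.M.mkQL_apply]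
  change T.q (ξ - T.j (T.q ξ)) = 0
  rw [map_sub, T.q_j, sub_self]

theorem momentumPart_j (χ : T.Q) : T.momentumPart (T.j χ) = 0 := by
  change T.j χ - T.j (T.q (T.j χ)) = 0
  rw [T.q_j, sub_self]

theorem inner_j_j_q (χ : T.Q) (ξ : L) : ⟪T.j χ, T.j (T.q ξ)⟫_ℝ = ⟪T.j χ, ξ⟫_ℝ := by
  have orthogonal := T.j_mem_orthogonal χ _ (T.momentumPart_mem ξ)
  conv_rhs => rw [← T.j_q_add_momentumPart ξ, inner_add_right,
    real_inner_comm (T.momentumPart ξ), orthogonal, add_zero]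

theorem norm_sq_eq_add_momentumPart (ξ : L) :
    ‖ξ‖ ^ 2 = ‖T.j (T.q ξ)‖ ^ 2 + ‖T.momentumPart ξ‖ ^ 2 := by
  have orthogonal := T.j_mem_orthogonal (T.q ξ) _ (T.momentumPart_mem ξ)
  conv_lhs => rw [← T.j_q_add_momentumPart ξ, norm_add_sq_real, real_inner_comm, orthogonal,
    mul_zero, add_zero]

theorem br_eq_inner_J_of_mem_M {m : L} (hm : m ∈ T.M) (ξ : L) : T.br m ξ = ⟪T.J m, ξ⟫_ℝ := by
  rw [T.inner_J_left, ω_def, hm ξ]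
  ring

theorem br_comm_of_mem_orthogonal {a b : L} (ha : a ∈ T.Mᗮ) (hb : b ∈ T.Mᗮ) :
    T.br a b = T.br b a := by
  obtain ⟨m, hm, rfl⟩ := T.orthogonal_le_map_J ha
  obtain ⟨n, hn, rfl⟩ := T.orthogonal_le_map_J hb
  have symplectic := T.J_symplectic m n
  rw [symplecticForm, symplecticForm, hm n, hn m] at symplectic
  linarith

theorem br_right_j_q (ξ τ : L) : T.br ξ (T.j (T.q τ)) = T.br ξ τ := by
  conv_rhs => rw [← T.j_q_add_momentumPart τ, map_add, T.momentumPart_mem τ ξ, add_zero]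

theorem Ω_q (ξ τ : L) : T.Ω (T.q ξ) (T.q τ) =
    ⟪T.j (T.q ξ), T.j (T.q τ)⟫_ℝ - Complex.I * T.br (T.j (T.q ξ)) τ := rfl

theorem Ω_comm (χ χ' : T.Q) : T.Ω χ χ' = T.Ω χ' χ := by
  obtain ⟨ξ, rfl⟩ := T.M.mkQ_surjective χ
  obtain ⟨τ, rfl⟩ := T.M.mkQ_surjective χ'
  change T.Ω (T.q ξ) (T.q τ) = T.Ω (T.q τ) (T.q ξ)
  rw [T.Ω_q, T.Ω_q, real_inner_comm, ← T.br_right_j_q _ τ, ← T.br_right_j_q _ ξ,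
    T.br_comm_of_mem_orthogonal (T.j_mem_orthogonal _) (T.j_mem_orthogonal _)]

theorem ΩHat_add_left (χ χ' : T.Q) (φ : T.QHat) :
    T.ΩHat (χ + χ') φ = T.ΩHat χ φ + T.ΩHat χ' φ := by
  simp only [ΩHat, gQ_add, map_add, brQ_add, Complex.ofReal_add]
  ring

theorem ΩHat_smul_left (s : ℝ) (χ : T.Q) (φ : T.QHat) :
    T.ΩHat (s • χ) φ = s * T.ΩHat χ φ := by
  simp only [ΩHat, gQ_smul, map_smul, brQ_smul, smul_eq_mul, Complex.ofReal_mul]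
  ring

theorem Ω_add_left (χ χ' ρ : T.Q) : T.Ω (χ + χ') ρ = T.Ω χ ρ + T.Ω χ' ρ :=
  T.ΩHat_add_left χ χ' (T.inclQ ρ)

theorem Ω_smul_left (s : ℝ) (χ ρ : T.Q) : T.Ω (s • χ) ρ = s * T.Ω χ ρ :=
  T.ΩHat_smul_left s χ (T.inclQ ρ)

theorem Ω_add_right (χ χ' ρ : T.Q) : T.Ω ρ (χ + χ') = T.Ω ρ χ + T.Ω ρ χ' := by
  rw [T.Ω_comm, T.Ω_add_left, T.Ω_comm χ, T.Ω_comm χ']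

theorem Ω_smul_right (s : ℝ) (χ ρ : T.Q) : T.Ω ρ (s • χ) = s * T.Ω ρ χ := by
  rw [T.Ω_comm, T.Ω_smul_left, T.Ω_comm]

/-! ### The Gaussian measure on the configuration space -/

/-- The Riesz representation of functionals on `Q` by vectors of `L`: the covariance structure of
the Gaussian measure `νQ`. -/
def rieszQ : StrongDual ℝ T.Q →ₗ[ℝ] L where
  toFun l := riesz L (l.comp T.q)
  map_add' l l' := by rw [ContinuousLinearMap.add_comp, map_add]
  map_smul' s l := by rw [ContinuousLinearMap.smul_comp, map_smul, RingHom.id_apply]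

theorem inner_rieszQ (l : StrongDual ℝ T.Q) (ξ : L) : ⟪T.rieszQ l, ξ⟫_ℝ = l (T.q ξ) :=
  inner_riesz (l.comp T.q) ξ

theorem rieszQ_gQ (χ : T.Q) : T.rieszQ (T.gQ χ) = T.j χ := by
  refine ext_inner_right ℝ fun ξ => ?_
  rw [T.inner_rieszQ, T.gQ_apply, T.inner_j_j_q]

theorem rieszQ_brQ_of_mem_M {m : L} (hm : m ∈ T.M) : T.rieszQ (T.brQ m) = T.J m := by
  refine ext_inner_right ℝ fun ξ => ?_
  rw [T.inner_rieszQ, T.brQ_q, T.br_eq_inner_J_of_mem_M hm]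

theorem gQ_surjective : Function.Surjective T.gQ := by
  refine fun l => ⟨T.q (T.rieszQ l), ?_⟩
  ext φ
  rw [T.gQ_apply, real_inner_comm, T.inner_j_j_q, real_inner_comm, T.inner_rieszQ, T.q_j]

theorem norm_j_le (χ : T.Q) : ‖T.j χ‖ ≤ ‖χ‖ := by
  refine le_of_forall_pos_le_add fun ε hε => ?_
  obtain ⟨ξ, rfl, hξ⟩ := Submodule.Quotient.norm_mk_lt χ hε
  exact (Submodule.norm_starProjection_apply_le _ ξ).trans hξ.le

theorem norm_rieszQ (l : StrongDual ℝ T.Q) : ‖T.rieszQ l‖ = ‖l‖ := by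
  refine le_antisymm ?_ (l.opNorm_le_bound (norm_nonneg _) fun χ => ?_)
  · change ‖riesz L (l.comp T.q)‖ ≤ ‖l‖
    rw [norm_riesz]
    refine ContinuousLinearMap.opNorm_le_bound _ (norm_nonneg l) fun ξ => ?_
    exact (l.le_opNorm _).trans
      (mul_le_mul_of_nonneg_left (Submodule.Quotient.norm_mk_le T.M ξ) (norm_nonneg l))
  · rw [← T.q_j χ, ← T.inner_rieszQ, T.q_j]
    exact (norm_inner_le_norm _ _).trans
      (mul_le_mul_of_nonneg_left (T.norm_j_le χ) (norm_nonneg _))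

theorem isAlgDualGaussian_νQ : IsAlgDualGaussian T.rieszQ (1 / 2) T.νQ := fun l => by
  rw [T.νQ_spec l, show ‖T.rieszQ l‖₊ = ‖l‖₊ from NNReal.eq (T.norm_rieszQ l)]

theorem memLp_of_mem_polyExp {ψ : T.QHat → ℂ} (hψ : ψ ∈ polyExp (StrongDual ℝ T.Q)) :
    MemLp ψ 2 T.νQ :=
  (T.isAlgDualGaussian_νQ.hasAllMoments_of_mem_polyExp hψ).memLp_two

theorem inclQ_eq_cameronMartin (χ : T.Q) :
    T.inclQ χ = cameronMartin T.rieszQ (1 / 2) ((2 : ℝ) • T.gQ χ) := by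
  ext l
  rw [cameronMartin_apply, map_smul, T.rieszQ_gQ, real_inner_smul_left, real_inner_comm,
    T.inner_rieszQ, T.q_j]
  change l χ = _
  push_cast
  ring

/-! ### Schrödinger coherent states -/

/-- The exponent of the coherent states, as a function of the displacement `ξ` and of the
configuration. Of `[ξ, ·]` only the part due to the momentum component of `ξ` survives, as the
imaginary part of `Ω` cancels the rest. -/
def coherentExponent (ξ : L) : T.QHat →ₗ[ℝ] ℂ := cEval (T.gQ (T.q ξ)) (T.brQ (T.momentumPart ξ))

theorem coherentExponent_apply (ξ : L) (φ : T.QHat) :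
    T.coherentExponent ξ φ = Complex.I * φ (T.brQ ξ) + T.ΩHat (T.q ξ) φ := by
  conv_rhs => rw [← T.j_q_add_momentumPart ξ, brQ_add, T.j_q_add_momentumPart]
  rw [coherentExponent, cEval_apply, ΩHat, map_add, Complex.ofReal_add]
  ring

theorem coherentExponent_inclQ (ξ τ : L) : T.coherentExponent ξ (T.inclQ (T.q τ)) =
    Complex.I * T.br ξ τ + T.Ω (T.q ξ) (T.q τ) :=
  T.coherentExponent_apply ξ _

theorem coherentExponent_smul (s : ℝ) (ξ : L) :
    T.coherentExponent (s • ξ) = s • T.coherentExponent ξ := by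
  rw [coherentExponent, map_smul, map_smul, gQ_smul, brQ_smul, cEval_smul, coherentExponent]

theorem coherentExponent_neg (ξ : L) : T.coherentExponent (-ξ) = -T.coherentExponent ξ := by
  rw [← neg_one_smul ℝ, coherentExponent_smul, neg_one_smul]

theorem conj_coherentExponent (ξ : L) (φ : T.QHat) : starRingEnd ℂ (T.coherentExponent ξ φ) =
    cEval (T.gQ (T.q ξ)) (-T.brQ (T.momentumPart ξ)) φ :=
  conj_cEval _ _ φ

theorem coherentExponent_add_conj (ξ : L) (φ : T.QHat) :
    T.coherentExponent ξ φ + starRingEnd ℂ (T.coherentExponent ξ φ) = 2 * φ (T.gQ (T.q ξ)) := by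
  rw [Complex.add_conj, coherentExponent, re_cEval, Complex.ofReal_mul, Complex.ofReal_ofNat]

theorem coherentS_eq (η ζ : A) (φ : T.QHat) : T.coherentS η ζ φ =
    Complex.exp (Complex.I * T.θ ζ (η -ᵥ ζ) - 1 / 2 * T.Ω (T.q (η -ᵥ ζ)) (T.q (η -ᵥ ζ))) *
      Complex.exp (T.coherentExponent (ζ -ᵥ η) φ) := by
  rw [coherentS, ← Complex.exp_add, ← neg_vsub_eq_vsub_rev η ζ, coherentExponent_neg,
    LinearMap.neg_apply, coherentExponent_apply]
  ring_nf

theorem coherentS_self (η : A) (φ : T.QHat) : T.coherentS η η φ = 1 := by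
  have hΩ : T.Ω 0 0 = 0 := by simp [Ω]
  have hexp : T.coherentExponent 0 = 0 := by simpa using T.coherentExponent_smul 0 0
  rw [coherentS_eq, vsub_self, hexp, map_zero, map_zero, hΩ]
  simp

theorem coherentS_mem_polyExp (η ζ : A) : T.coherentS η ζ ∈ polyExp (StrongDual ℝ T.Q) := by
  rw [funext (T.coherentS_eq η ζ)]
  exact Subalgebra.smul_mem _ (exp_cEval_mem_polyExp _ _) _

theorem memLp_coherentS (η ζ : A) : MemLp (T.coherentS η ζ) 2 T.νQ :=
  T.memLp_of_mem_polyExp (T.coherentS_mem_polyExp η ζ)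

/-- The coherent state of `ζ` as an element of the Hilbert space of `η`-reduced wave functions. -/
def coherentLp (η ζ : A) : Lp ℂ 2 T.νQ := (T.memLp_coherentS η ζ).toLp (T.coherentS η ζ)

theorem eq_zero_of_inner_coherentLp_eq_zero (η : A) (f : Lp ℂ 2 T.νQ)
    (hf : ∀ ζ, ⟪T.coherentLp η ζ, f⟫_ℂ = 0) : f = 0 := by
  refine Lp.eq_zero_iff_ae_eq_zero.2 (ae_eq_zero_of_integral_exp_mul_eq_zero
    (fun l => (T.isAlgDualGaussian_νQ.hasAllMoments_exp l).ofReal.memLp_two.integrable_mul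
      (Lp.memLp f)) fun l => ?_)
  obtain ⟨χ, rfl⟩ := T.gQ_surjective l
  obtain ⟨k, hk, hK⟩ : ∃ k : ℂ, k ≠ 0 ∧ ∀ φ : T.QHat,
      starRingEnd ℂ (T.coherentS η (T.j χ +ᵥ η) φ) = k * (Real.exp (φ (T.gQ χ)) : ℂ) := by
    have hbr : T.brQ 0 = 0 := by simpa using T.brQ_smul 0 0
    have hexp (φ : T.QHat) : T.coherentExponent (T.j χ) φ = φ (T.gQ χ) := by
      rw [coherentExponent, T.momentumPart_j, T.q_j, hbr, cEval_zero_right]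
    simp only [T.coherentS_eq η (T.j χ +ᵥ η), map_mul, vadd_vsub, hexp, ← Complex.ofReal_exp,
      Complex.conj_ofReal]
    exact ⟨_, (map_ne_zero (starRingEnd ℂ)).2 (Complex.exp_ne_zero _), fun φ => rfl⟩
  have orthogonal := hf (T.j χ +ᵥ η)
  rw [coherentLp, inner_toLp_left] at orthogonal
  simp only [hK, mul_assoc, integral_const_mul] at orthogonal
  exact (mul_eq_zero.1 orthogonal).resolve_left hk

/-! ### Change of base point -/

theorem coherentS_change_base (η η' ζ : A) (φ : T.QHat) : T.coherentS η' ζ φ =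
    T.coherentS η ζ (φ + T.inclQ (T.q (η' -ᵥ η))) * T.coherentS η' η φ := by
  have displacement : η' -ᵥ ζ = (η -ᵥ ζ) + (η' -ᵥ η) := by rw [add_comm, vsub_add_vsub_cancel]
  have potential : T.θ η (η' -ᵥ η) = T.θ ζ (η' -ᵥ η) + T.br (η -ᵥ ζ) (η' -ᵥ η) :=
    T.θ_eq_add_br ζ η _
  have translate : T.ΩHat (T.q (η -ᵥ ζ)) (φ + T.inclQ (T.q (η' -ᵥ η))) =
      T.ΩHat (T.q (η -ᵥ ζ)) φ + T.Ω (T.q (η -ᵥ ζ)) (T.q (η' -ᵥ η)) := by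
    simp only [← T.ΩHat_incl, ΩHat, LinearMap.add_apply, Complex.ofReal_add]
    ring
  have eval_translate : (φ + T.inclQ (T.q (η' -ᵥ η))) (T.brQ (η -ᵥ ζ)) =
      φ (T.brQ (η -ᵥ ζ)) + T.br (η -ᵥ ζ) (η' -ᵥ η) := rfl
  rw [coherentS, coherentS, coherentS, ← Complex.exp_add, displacement, translate, eval_translate,
    potential]
  simp only [map_add, Ω_add_left, Ω_add_right, brQ_add, ΩHat_add_left,
    T.Ω_comm (T.q (η' -ᵥ η)) (T.q (η -ᵥ ζ)), Complex.ofReal_add]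
  ring_nf

theorem norm_sq_coherentS_eq_density (η ζ : A) (φ : T.QHat) : ‖T.coherentS η ζ φ‖ ^ 2 =
    Real.exp (φ (-((2 : ℝ) • T.gQ (T.q (η -ᵥ ζ)))) -
      (1 / 2 : ℝ≥0) * ‖T.rieszQ (-((2 : ℝ) • T.gQ (T.q (η -ᵥ ζ))))‖ ^ 2 / 2) := by
  rw [coherentS, Complex.norm_exp, ← Real.exp_nat_mul, map_neg, map_neg, map_smul, map_smul,
    norm_neg, norm_smul, T.rieszQ_gQ]
  have Ω_re (χ : T.Q) : (T.Ω χ χ).re = ‖T.j χ‖ ^ 2 := by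
    rw [Ω, Complex.sub_re, Complex.I_mul_re, Complex.ofReal_re, Complex.ofReal_im, neg_zero,
      sub_zero, real_inner_self_eq_norm_sq]
  have half_re (z : ℂ) : (1 / 2 * z).re = z.re / 2 := by
    rw [one_div_mul_eq_div, Complex.div_ofNat_re]
  rw [ΩHat, Complex.sub_re, Complex.sub_re, Complex.sub_re, Complex.sub_re, half_re, Ω_re]
  simp only [Complex.I_mul_re, Complex.ofReal_re, Complex.ofReal_im, Real.norm_ofNat, smul_eq_mul]
  push_cast
  ring_nf

theorem integral_norm_sq_coherentS_mul (η η' : A) (G : T.QHat → ℂ) :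
    ∫ φ, (‖T.coherentS η' η φ‖ ^ 2 : ℝ) * G (φ + T.inclQ (T.q (η' -ᵥ η))) ∂T.νQ =
      ∫ φ, G φ ∂T.νQ := by
  simp only [norm_sq_coherentS_eq_density]
  rw [← T.isAlgDualGaussian_νQ.integral_comp_add_cameronMartin _
    fun φ => G (φ + T.inclQ (T.q (η' -ᵥ η)))]
  simp only [map_neg, ← inclQ_eq_cameronMartin, neg_add_cancel_right]

theorem integrable_norm_sq_coherentS_mul (η η' : A) {G : T.QHat → ℂ} (hG : Integrable G T.νQ) :
    Integrable (fun φ => ((‖T.coherentS η' η φ‖ ^ 2 : ℝ) : ℂ) *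
      G (φ + T.inclQ (T.q (η' -ᵥ η)))) T.νQ := by
  have shift := (T.isAlgDualGaussian_νQ.integrable_comp_add_cameronMartin_iff
    (-((2 : ℝ) • T.gQ (T.q (η' -ᵥ η)))) fun φ => G (φ + T.inclQ (T.q (η' -ᵥ η)))).1
      (by simpa only [map_neg, ← inclQ_eq_cameronMartin, neg_add_cancel_right] using hG)
  refine (shift.const_mul (Real.exp (-((1 / 2 : ℝ≥0) *
    ‖T.rieszQ (-((2 : ℝ) • T.gQ (T.q (η' -ᵥ η))))‖ ^ 2 / 2)) : ℂ)).congr (.of_forall fun φ => ?_)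
  simp only [norm_sq_coherentS_eq_density]
  rw [sub_eq_neg_add, Real.exp_add, Complex.ofReal_mul, mul_assoc]

theorem memLp_change_base (η η' : A) (ψ : Lp ℂ 2 T.νQ) :
    MemLp (fun φ => ψ (φ + T.inclQ (T.q (η' -ᵥ η))) * T.coherentS η' η φ) 2 T.νQ := by
  have meas : AEStronglyMeasurable
      (fun φ => ψ (φ + T.inclQ (T.q (η' -ᵥ η))) * T.coherentS η' η φ) T.νQ :=
    ((Lp.stronglyMeasurable ψ).comp_measurable
      (algDualShift (T.inclQ (T.q (η' -ᵥ η)))).measurable).aestronglyMeasurable.mul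
      (T.memLp_coherentS η' η).1
  rw [memLp_two_iff_integrable_sq_norm meas]
  have integrable_sq : Integrable (fun φ => ((‖ψ φ‖ ^ 2 : ℝ) : ℂ)) T.νQ :=
    ((memLp_two_iff_integrable_sq_norm (Lp.stronglyMeasurable ψ).aestronglyMeasurable).1
      (Lp.memLp ψ)).ofReal
  refine (T.integrable_norm_sq_coherentS_mul η η' integrable_sq).re.congr (.of_forall fun φ => ?_)
  simp only [← Complex.ofReal_mul, RCLike.re_to_complex, Complex.ofReal_re, norm_mul, mul_pow,
    mul_comm]

/-! ### The coherent state transform of Schrödinger wave functions -/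

/-- The coherent state transform: the function on `A` whose value at `ζ` is the inner product of
the coherent state of `ζ` with the state of `η`-reduced wave function `ψ`. -/
def waveS (η : A) (ψ : T.QHat → ℂ) (ζ : A) : ℂ :=
  ∫ φ, starRingEnd ℂ (T.coherentS η ζ φ) * ψ φ ∂T.νQ

theorem inner_coherentLp (η ζ : A) (f : Lp ℂ 2 T.νQ) :
    ⟪T.coherentLp η ζ, f⟫_ℂ = T.waveS η f ζ :=
  inner_toLp_left _ f

theorem waveS_congr (η : A) {ψ ψ' : T.QHat → ℂ} (h : ψ =ᵐ[T.νQ] ψ') :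
    T.waveS η ψ = T.waveS η ψ' := by
  ext ζ
  exact integral_congr_ae (h.mono fun φ hφ => congrArg (_ * ·) hφ)

theorem integrable_conj_coherentS_mul (η ζ : A) {ψ : T.QHat → ℂ} (hψ : MemLp ψ 2 T.νQ) :
    Integrable (fun φ => starRingEnd ℂ (T.coherentS η ζ φ) * ψ φ) T.νQ :=
  (T.memLp_coherentS η ζ).star.integrable_mul hψ

theorem waveS_add (η : A) {ψ ψ' : T.QHat → ℂ} (hψ : MemLp ψ 2 T.νQ) (hψ' : MemLp ψ' 2 T.νQ) :
    T.waveS η (ψ + ψ') = T.waveS η ψ + T.waveS η ψ' := by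
  ext ζ
  simp only [waveS, Pi.add_apply, mul_add]
  exact integral_add (T.integrable_conj_coherentS_mul η ζ hψ)
    (T.integrable_conj_coherentS_mul η ζ hψ')

theorem waveS_smul (η : A) (z : ℂ) (ψ : T.QHat → ℂ) : T.waveS η (z • ψ) = z • T.waveS η ψ := by
  ext ζ
  simp only [waveS, Pi.smul_apply, smul_eq_mul, mul_left_comm, integral_const_mul]

theorem waveS_change_base (η η' : A) (ψ : T.QHat → ℂ) :
    T.waveS η' (fun φ => ψ (φ + T.inclQ (T.q (η' -ᵥ η))) * T.coherentS η' η φ) =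
      T.waveS η ψ := by
  ext ζ
  refine Eq.trans ?_ (T.integral_norm_sq_coherentS_mul η η' _)
  refine integral_congr_ae (.of_forall fun φ => ?_)
  simp only [T.coherentS_change_base η η' ζ φ, map_mul, Complex.ofReal_pow, ← Complex.conj_mul']
  ring

theorem integral_coherentS (η ζ : A) : ∫ φ, T.coherentS η ζ φ ∂T.νQ = T.α ζ η := by
  set ξ := ζ -ᵥ η
  set a := T.j (T.q ξ) with ha
  set m := T.momentumPart ξ with hm
  have reverse : η -ᵥ ζ = -ξ := (neg_vsub_eq_vsub_rev ζ η).symm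
  have potential : T.θ η ξ = T.θ ζ ξ - T.br ξ ξ := by
    rw [T.θ_eq_add_br ζ η, reverse, map_neg, neg_apply, sub_eq_add_neg]
  have br_split : T.br ξ ξ = T.br a ξ + T.br m ξ := by
    rw [← add_apply, ← map_add, T.j_q_add_momentumPart]
  have cross : ⟪a, T.J m⟫_ℝ = T.br m ξ := by
    rw [real_inner_comm, ← T.br_eq_inner_J_of_mem_M (T.momentumPart_mem ξ), T.br_right_j_q]
  have Ω_self : T.Ω (T.q (-ξ)) (T.q (-ξ)) = (‖a‖ ^ 2 : ℝ) - Complex.I * T.br a ξ := by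
    rw [T.Ω_q, map_neg, map_neg, inner_neg_neg, map_neg, map_neg, neg_apply, neg_neg,
      real_inner_self_eq_norm_sq]
  simp only [coherentS_eq, coherentExponent]
  rw [integral_const_mul, T.isAlgDualGaussian_νQ.integral_exp_cEval, ← Complex.exp_add,
    T.rieszQ_gQ, T.rieszQ_brQ_of_mem_M (T.momentumPart_mem _), T.norm_J, α, reverse, inner_neg_neg,
    real_inner_self_eq_norm_sq, T.norm_sq_eq_add_momentumPart ξ, Ω_self, ← ha, ← hm, cross]
  simp only [map_neg, potential, br_split]
  push_cast
  ring_nf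

theorem waveS_coherentS (η ζ : A) : T.waveS η (T.coherentS η ζ) = T.coherentH ζ := by
  ext ζ'
  have self_pairing : T.waveS ζ' (T.coherentS ζ' ζ) ζ' = T.α ζ ζ' := by
    simp only [waveS, coherentS_self, map_one, one_mul, integral_coherentS]
  rw [coherentH, ← self_pairing, ← T.waveS_change_base η ζ']
  simp only [← T.coherentS_change_base η ζ' ζ]

/-! ### Infinitesimal translations of coherent states -/

/-- The constant term of the derivative at `ζ` along `X` of the exponent of the `η`-reduced coherent
states; the configuration-dependent term is `coherentExponent X`. -/
def coherentDrift (η ζ : A) (X : L) : ℂ :=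
  T.coherentExponent (η -ᵥ ζ) (T.inclQ (T.q X)) -
    Complex.I * ((2 * T.ω (η -ᵥ ζ) X : ℝ) + T.θ ζ X)

theorem coherentS_vadd (η ζ : A) (X : L) (t : ℝ) (φ : T.QHat) : T.coherentS η (t • X +ᵥ ζ) φ =
    Complex.exp (t * T.coherentDrift η ζ X +
      t ^ 2 * (-Complex.I * T.br X X - 1 / 2 * T.Ω (T.q X) (T.q X))) *
        (Complex.exp (t * T.coherentExponent X φ) * T.coherentS η ζ φ) := by
  have displacement : η -ᵥ (t • X +ᵥ ζ) = (η -ᵥ ζ) + (-t) • X := by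
    rw [vsub_vadd_eq_vsub_sub, neg_smul, sub_eq_add_neg]
  rw [coherentS, coherentS, displacement, ← Complex.exp_add, ← Complex.exp_add, coherentDrift,
    coherentExponent_inclQ, coherentExponent_apply, T.θ_vadd, ω_def]
  simp only [map_add, map_smul, Ω_add_left, Ω_add_right, Ω_smul_left, Ω_smul_right, brQ_add,
    brQ_smul, ΩHat_add_left, ΩHat_smul_left, smul_apply, smul_eq_mul,
    T.Ω_comm (T.q X) (T.q (η -ᵥ ζ))]
  push_cast
  ring_nf

theorem hasDerivAt_waveS (η ζ : A) (X : L) {ψ : T.QHat → ℂ} (hψ : MemLp ψ 2 T.νQ) :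
    HasDerivAt (fun t : ℝ => T.waveS η ψ (t • X +ᵥ ζ))
      (starRingEnd ℂ (T.coherentDrift η ζ X) * T.waveS η ψ ζ +
        T.waveS η (fun φ => starRingEnd ℂ (T.coherentExponent X φ) * ψ φ) ζ) 0 := by
  set κ : ℂ := -Complex.I * T.br X X - 1 / 2 * T.Ω (T.q X) (T.q X)
  have conj_vadd (t : ℝ) (φ : T.QHat) : starRingEnd ℂ (T.coherentS η (t • X +ᵥ ζ) φ) * ψ φ =
      Complex.exp (t * starRingEnd ℂ (T.coherentDrift η ζ X) + t ^ 2 * starRingEnd ℂ κ) *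
        (Complex.exp (t * cEval (T.gQ (T.q X)) (-T.brQ (T.momentumPart X)) φ) *
          (starRingEnd ℂ (T.coherentS η ζ φ) * ψ φ)) := by
    simp only [coherentS_vadd, map_mul, ← Complex.exp_conj, map_add, map_pow, Complex.conj_ofReal,
      conj_coherentExponent, mul_assoc, κ]
  have constant_factor : HasDerivAt (fun t : ℝ => Complex.exp
      (t * starRingEnd ℂ (T.coherentDrift η ζ X) + t ^ 2 * starRingEnd ℂ κ))
        (starRingEnd ℂ (T.coherentDrift η ζ X)) 0 := by
    have id_deriv := Complex.ofRealCLM.hasDerivAt (x := 0)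
    refine (((id_deriv.mul_const _).add ((id_deriv.pow 2).mul_const _)).cexp).congr_deriv ?_
    simp
  have integral_factor := T.isAlgDualGaussian_νQ.hasDerivAt_integral_exp_smul_cEval
    (T.integrable_conj_coherentS_mul η ζ hψ).1 (fun g hg => by
      have moments := T.isAlgDualGaussian_νQ.hasAllMoments_of_mem_polyExp
        (T.coherentS_mem_polyExp η ζ)
      refine ((hg.mul moments.norm).memLp_two.integrable_mul hψ.norm).congr
        (.of_forall fun φ => ?_)
      simp only [Pi.mul_apply, norm_mul, RCLike.norm_conj, mul_assoc])
    (T.gQ (T.q X)) (-T.brQ (T.momentumPart X))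
  simp only [waveS, conj_vadd, integral_const_mul]
  refine (constant_factor.mul integral_factor).congr_deriv ?_
  simp [conj_coherentExponent, mul_left_comm]

/-! ### Intertwining of the quantized observables -/

theorem conj_coherentS_eq_smul (η ζ : A) : ∃ k : ℂ,
    (fun φ => starRingEnd ℂ (T.coherentS η ζ φ)) = k • fun φ =>
      Complex.exp (cEval (T.gQ (T.q (ζ -ᵥ η))) (-T.brQ (T.momentumPart (ζ -ᵥ η))) φ) := by
  simp only [coherentS_eq, map_mul, ← Complex.exp_conj, conj_coherentExponent]
  exact ⟨_, rfl⟩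

theorem conj_coherentS_mem_polyExp (η ζ : A) :
    (fun φ => starRingEnd ℂ (T.coherentS η ζ φ)) ∈ polyExp (StrongDual ℝ T.Q) := by
  obtain ⟨k, hk⟩ := T.conj_coherentS_eq_smul η ζ
  rw [hk]
  exact Subalgebra.smul_mem _ (exp_cEval_mem_polyExp _ _) k

theorem hasLineDerivAt_conj_coherentS (η ζ : A) (φ h : T.QHat) :
    HasLineDerivAt ℝ (fun φ => starRingEnd ℂ (T.coherentS η ζ φ))
      (starRingEnd ℂ (T.coherentExponent (ζ -ᵥ η) h) * starRingEnd ℂ (T.coherentS η ζ φ)) φ h := by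
  obtain ⟨k, hk⟩ := T.conj_coherentS_eq_smul η ζ
  rw [hk, congrFun hk φ, conj_coherentExponent, Pi.smul_apply, mul_smul_comm]
  exact HasDerivAt.const_smul k (hasLineDerivAt_exp_cEval _ _ φ h)

theorem coherentExponent_mul_mem_polyExp (ξ : L) {ψ : T.QHat → ℂ}
    (hψ : ψ ∈ polyExp (StrongDual ℝ T.Q)) :
    ⇑(T.coherentExponent ξ) * ψ ∈ polyExp (StrongDual ℝ T.Q) :=
  mul_mem (cEval_mem_polyExp _ _) hψ

theorem conj_coherentExponent_mul_mem_polyExp (ξ : L) {ψ : T.QHat → ℂ}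
    (hψ : ψ ∈ polyExp (StrongDual ℝ T.Q)) :
    (fun φ => starRingEnd ℂ (T.coherentExponent ξ φ) * ψ φ) ∈ polyExp (StrongDual ℝ T.Q) := by
  simp only [conj_coherentExponent]
  exact mul_mem (cEval_mem_polyExp _ _) hψ

theorem waveS_lineDeriv (η ζ : A) (X : L) {ψ : T.QHat → ℂ}
    (hψ : ψ ∈ polyExp (StrongDual ℝ T.Q)) :
    T.waveS η (fun φ => lineDeriv ℝ ψ φ (T.inclQ (T.q X))) ζ =
      T.waveS η (⇑(T.coherentExponent X) * ψ) ζ +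
      T.waveS η (fun φ => starRingEnd ℂ (T.coherentExponent X φ) * ψ φ) ζ -
        starRingEnd ℂ (T.coherentExponent (ζ -ᵥ η) (T.inclQ (T.q X))) * T.waveS η ψ ζ := by
  set h := T.inclQ (T.q X) with h_def
  set z := starRingEnd ℂ (T.coherentExponent (ζ -ᵥ η) h)
  have leibniz (φ : T.QHat) :
      lineDeriv ℝ (fun φ => starRingEnd ℂ (T.coherentS η ζ φ) * ψ φ) φ h =
        starRingEnd ℂ (T.coherentS η ζ φ) * lineDeriv ℝ ψ φ h +
          z * (starRingEnd ℂ (T.coherentS η ζ φ) * ψ φ) := by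
    have product := HasDerivAt.fun_mul (T.hasLineDerivAt_conj_coherentS η ζ φ h)
      (lineDifferentiableAt_of_mem_polyExp hψ φ h).hasLineDerivAt
    simp only [zero_smul, add_zero] at product
    exact product.deriv.trans (by ring)
  have integrable {χ : T.QHat → ℂ} (hχ : χ ∈ polyExp (StrongDual ℝ T.Q)) :=
    T.integrable_conj_coherentS_mul η ζ (T.memLp_of_mem_polyExp hχ)
  have derivative_side :
      ∫ φ, lineDeriv ℝ (fun φ => starRingEnd ℂ (T.coherentS η ζ φ) * ψ φ) φ h ∂T.νQ =
        T.waveS η (fun φ => lineDeriv ℝ ψ φ h) ζ + z * T.waveS η ψ ζ := by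
    simp only [leibniz]
    rw [integral_add (integrable (lineDeriv_mem_polyExp hψ h)) ((integrable hψ).const_mul z),
      integral_const_mul, waveS, waveS]
  have multiplication_side : ∫ φ, φ ((2 : ℝ) • T.gQ (T.q X)) *
      (starRingEnd ℂ (T.coherentS η ζ φ) * ψ φ) ∂T.νQ =
        T.waveS η (⇑(T.coherentExponent X) * ψ) ζ +
          T.waveS η (fun φ => starRingEnd ℂ (T.coherentExponent X φ) * ψ φ) ζ := by
    rw [waveS, waveS, ← integral_add (integrable (T.coherentExponent_mul_mem_polyExp X hψ))
      (integrable (T.conj_coherentExponent_mul_mem_polyExp X hψ))]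
    congr 1 with φ
    rw [map_smul, smul_eq_mul, Complex.ofReal_mul, Complex.ofReal_ofNat,
      ← coherentExponent_add_conj, Pi.mul_apply]
    ring
  rw [eq_sub_iff_add_eq, ← derivative_side, ← multiplication_side, h_def,
    inclQ_eq_cameronMartin]
  exact T.isAlgDualGaussian_νQ.integral_lineDeriv_cameronMartin
    (mul_mem (T.conj_coherentS_mem_polyExp η ζ) hψ) _

theorem quantS_eq (η : A) (F : A →ᴬ[ℝ] ℝ) (ψ : T.QHat → ℂ) : T.quantS η F ψ =
    (F η : ℂ) • ψ + Complex.I • (⇑(T.coherentExponent (T.X F)) * ψ +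
      (-1 : ℂ) • fun φ => lineDeriv ℝ ψ φ (T.inclQ (T.q (T.X F)))) := by
  ext φ
  simp only [quantS, lineDeriv, Pi.add_apply, Pi.smul_apply, Pi.mul_apply, smul_eq_mul,
    coherentExponent_apply]
  linear_combination (-(φ (T.brQ (T.X F)) * ψ φ)) * Complex.I_sq

theorem quantS_mem_polyExp (η : A) (F : A →ᴬ[ℝ] ℝ) {ψ : T.QHat → ℂ}
    (hψ : ψ ∈ polyExp (StrongDual ℝ T.Q)) : T.quantS η F ψ ∈ polyExp (StrongDual ℝ T.Q) := by
  rw [quantS_eq]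
  exact add_mem (Subalgebra.smul_mem _ hψ _) (Subalgebra.smul_mem _ (add_mem
    (T.coherentExponent_mul_mem_polyExp _ hψ)
    (Subalgebra.smul_mem _ (lineDeriv_mem_polyExp hψ _) _)) _)

theorem conj_coherentDrift_X (η ζ : A) (F : A →ᴬ[ℝ] ℝ) :
    Complex.I * starRingEnd ℂ (T.coherentDrift η ζ (T.X F)) =
      (F ζ - T.θ ζ (T.X F) : ℝ) - F η - Complex.I *
        starRingEnd ℂ (T.coherentExponent (ζ -ᵥ η) (T.inclQ (T.q (T.X F)))) := by
  have linear_part : F.contLinear (η -ᵥ ζ) = F η - F ζ := F.toAffineMap.linearMap_vsub η ζ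
  rw [coherentDrift, T.X_spec, linear_part, ← neg_vsub_eq_vsub_rev η ζ, coherentExponent_neg]
  simp only [map_sub, map_mul, map_add, map_neg, Complex.conj_I, Complex.conj_ofReal,
    LinearMap.neg_apply, Complex.ofReal_sub]
  linear_combination ((F η : ℂ) - F ζ + T.θ ζ (T.X F)) * Complex.I_sq

theorem waveS_quantS (η : A) (F : A →ᴬ[ℝ] ℝ) {ψ : T.QHat → ℂ}
    (hψ : ψ ∈ polyExp (StrongDual ℝ T.Q)) :
    T.waveS η (T.quantS η F ψ) = T.quantH F (T.waveS η ψ) := by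
  have memLp {χ : T.QHat → ℂ} (hχ : χ ∈ polyExp (StrongDual ℝ T.Q)) : MemLp χ 2 T.νQ :=
    T.memLp_of_mem_polyExp hχ
  have exponent_mem := T.coherentExponent_mul_mem_polyExp (T.X F) hψ
  have lineDeriv_mem := Subalgebra.smul_mem _
    (lineDeriv_mem_polyExp hψ (T.inclQ (T.q (T.X F)))) (-1 : ℂ)
  rw [quantS_eq, T.waveS_add η (memLp (Subalgebra.smul_mem _ hψ _))
      (memLp (Subalgebra.smul_mem _ (add_mem exponent_mem lineDeriv_mem) _)), waveS_smul,
    waveS_smul, T.waveS_add η (memLp exponent_mem) (memLp lineDeriv_mem), waveS_smul]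
  ext ζ
  rw [quantH, (T.hasDerivAt_waveS η ζ (T.X F) (memLp hψ)).deriv]
  simp only [Pi.add_apply, Pi.smul_apply, smul_eq_mul, T.waveS_lineDeriv η ζ (T.X F) hψ]
  linear_combination T.waveS η ψ ζ * T.conj_coherentDrift_X η ζ F

/-! ### The subspaces generated by observables from coherent states -/

theorem quantS_add (η : A) (F : A →ᴬ[ℝ] ℝ) {ψ ψ' : T.QHat → ℂ}
    (hψ : ψ ∈ polyExp (StrongDual ℝ T.Q)) (hψ' : ψ' ∈ polyExp (StrongDual ℝ T.Q)) :
    T.quantS η F (ψ + ψ') = T.quantS η F ψ + T.quantS η F ψ' := by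
  ext φ
  simp only [quantS, Pi.add_apply]
  rw [deriv_fun_add (lineDifferentiableAt_of_mem_polyExp hψ φ _)
    (lineDifferentiableAt_of_mem_polyExp hψ' φ _)]
  ring

theorem quantS_smul (η : A) (F : A →ᴬ[ℝ] ℝ) (z : ℂ) (ψ : T.QHat → ℂ) :
    T.quantS η F (z • ψ) = z • T.quantS η F ψ := by
  ext φ
  simp only [quantS, Pi.smul_apply, smul_eq_mul, deriv_const_mul_field']
  ring

theorem HS_c_le_polyExp (η : A) :
    T.HS_c η ≤ (polyExp (StrongDual ℝ T.Q)).toSubmodule :=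
  Submodule.span_le.2 (Set.range_subset_iff.2 (T.coherentS_mem_polyExp η))

theorem foldr_quantS_mem_polyExp (η : A) (Fs : List (A →ᴬ[ℝ] ℝ)) {ψ : T.QHat → ℂ}
    (hψ : ψ ∈ polyExp (StrongDual ℝ T.Q)) :
    Fs.foldr (T.quantS η) ψ ∈ polyExp (StrongDual ℝ T.Q) := by
  induction Fs with
  | nil => exact hψ
  | cons F Fs ih => exact T.quantS_mem_polyExp η F ih

theorem foldr_quantS_subset_polyExp (η : A) :
    {χ | ∃ Fs : List (A →ᴬ[ℝ] ℝ), ∃ ψ ∈ T.HS_c η, χ = Fs.foldr (T.quantS η) ψ} ⊆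
      (polyExp (StrongDual ℝ T.Q)).toSubmodule := by
  rintro _ ⟨Fs, ψ, hψ, rfl⟩
  exact T.foldr_quantS_mem_polyExp η Fs (T.HS_c_le_polyExp η hψ)

theorem HS_cp_le_polyExp (η : A) :
    T.HS_cp η ≤ (polyExp (StrongDual ℝ T.Q)).toSubmodule :=
  Submodule.span_le.2 (T.foldr_quantS_subset_polyExp η)

theorem memLp_of_mem_HS_cp {η : A} {ψ : T.QHat → ℂ} (hψ : ψ ∈ T.HS_cp η) : MemLp ψ 2 T.νQ :=
  T.memLp_of_mem_polyExp (T.HS_cp_le_polyExp η hψ)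

theorem lineDifferentiableAt_of_mem_HS_cp {η : A} {ψ : T.QHat → ℂ} (hψ : ψ ∈ T.HS_cp η)
    (φ h : T.QHat) : LineDifferentiableAt ℝ ψ φ h :=
  lineDifferentiableAt_of_mem_polyExp (T.HS_cp_le_polyExp η hψ) φ h

theorem quantS_mem_HS_cp {η : A} (F : A →ᴬ[ℝ] ℝ) {ψ : T.QHat → ℂ} (hψ : ψ ∈ T.HS_cp η) :
    T.quantS η F ψ ∈ T.HS_cp η := by
  have image_span := image_span_of_map_add_of_map_smul (f := T.quantS η F)
    (fun _ hψ _ hψ' => T.quantS_add η F hψ hψ') (fun z ψ _ => T.quantS_smul η F z ψ)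
    (T.foldr_quantS_subset_polyExp η)
  have image_mem := image_span.subset (Set.mem_image_of_mem _ hψ)
  refine Submodule.span_mono ?_ image_mem
  rintro _ ⟨_, ⟨Fs, ψ, hψ, rfl⟩, rfl⟩
  exact ⟨F :: Fs, ψ, hψ, rfl⟩

theorem waveS_foldr_quantS (η : A) (Fs : List (A →ᴬ[ℝ] ℝ)) {ψ : T.QHat → ℂ}
    (hψ : ψ ∈ polyExp (StrongDual ℝ T.Q)) :
    T.waveS η (Fs.foldr (T.quantS η) ψ) = Fs.foldr T.quantH (T.waveS η ψ) := by
  induction Fs with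
  | nil => rfl
  | cons F Fs ih =>
    rw [List.foldr_cons, List.foldr_cons, T.waveS_quantS η F (T.foldr_quantS_mem_polyExp η Fs hψ),
      ih]

theorem image_waveS_span (η : A) {s : Set (T.QHat → ℂ)}
    (hs : s ⊆ (polyExp (StrongDual ℝ T.Q)).toSubmodule) :
    T.waveS η '' Submodule.span ℂ s = Submodule.span ℂ (T.waveS η '' s) :=
  image_span_of_map_add_of_map_smul
    (fun _ hψ _ hψ' => T.waveS_add η (T.memLp_of_mem_polyExp hψ) (T.memLp_of_mem_polyExp hψ'))
    (fun z ψ _ => T.waveS_smul η z ψ) hs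

theorem image_waveS_HS_c (η : A) : T.waveS η '' T.HS_c η = T.HHat_c := by
  rw [HS_c, T.image_waveS_span η (Submodule.span_le.1 (T.HS_c_le_polyExp η)), ← Set.range_comp,
    HHat_c, ← funext (T.waveS_coherentS η)]
  rfl

theorem image_waveS_HS_cp (η : A) : T.waveS η '' T.HS_cp η = T.HHat_cp := by
  have foldr_eq {Fs : List (A →ᴬ[ℝ] ℝ)} {ψ : T.QHat → ℂ} (hψ : ψ ∈ T.HS_c η) :=
    T.waveS_foldr_quantS η Fs (T.HS_c_le_polyExp η hψ)
  rw [HS_cp, T.image_waveS_span η (T.foldr_quantS_subset_polyExp η), HHat_cp]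
  congr 2
  refine Set.Subset.antisymm ?_ ?_
  · rintro _ ⟨_, ⟨Fs, ψ, hψ, rfl⟩, rfl⟩
    exact ⟨Fs, _, (T.image_waveS_HS_c η).subset (Set.mem_image_of_mem _ hψ), foldr_eq hψ⟩
  · rintro _ ⟨Fs, χ, hχ, rfl⟩
    obtain ⟨ψ, hψ, rfl⟩ := (T.image_waveS_HS_c η).superset hχ
    exact ⟨_, ⟨Fs, ψ, hψ, rfl⟩, foldr_eq hψ⟩

theorem waveS_mem_HHat_cp {η : A} {ψ : T.QHat → ℂ} (hψ : ψ ∈ T.HS_cp η) :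
    T.waveS η ψ ∈ T.HHat_cp :=
  (T.image_waveS_HS_cp η).subset (Set.mem_image_of_mem _ hψ)

theorem exists_waveS_eq_of_mem_HHat_cp (η : A) {χ : A → ℂ} (hχ : χ ∈ T.HHat_cp) :
    ∃ ψ ∈ T.HS_cp η, T.waveS η ψ = χ :=
  (T.image_waveS_HS_cp η).superset hχ

theorem differentiableAt_of_mem_HHat_cp {χ : A → ℂ} (hχ : χ ∈ T.HHat_cp) (ζ : A) (ξ : L) :
    DifferentiableAt ℝ (fun t : ℝ => χ (t • ξ +ᵥ ζ)) 0 := by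
  obtain ⟨ψ, hψ, rfl⟩ := T.exists_waveS_eq_of_mem_HHat_cp ζ hχ
  exact (T.hasDerivAt_waveS ζ ζ ξ (T.memLp_of_mem_HS_cp hψ)).differentiableAt

theorem quantH_mem_HHat_cp (F : A →ᴬ[ℝ] ℝ) {χ : A → ℂ} (hχ : χ ∈ T.HHat_cp) :
    T.quantH F χ ∈ T.HHat_cp := by
  obtain ⟨η⟩ : Nonempty A := AddTorsor.nonempty (G := L)
  obtain ⟨ψ, hψ, rfl⟩ := T.exists_waveS_eq_of_mem_HHat_cp η hχ
  rw [← T.waveS_quantS η F (T.HS_cp_le_polyExp η hψ)]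
  exact T.waveS_mem_HHat_cp (T.quantS_mem_HS_cp F hψ)

/-! ### The isomorphism of the representations -/

theorem inner_coherentLp_coherentLp (η ζ ζ' : A) :
    ⟪T.coherentLp η ζ, T.coherentLp η ζ'⟫_ℂ = T.α ζ' ζ := by
  rw [inner_coherentLp, coherentLp, T.waveS_congr η (MemLp.coeFn_toLp _), waveS_coherentS,
    coherentH]

theorem exists_isCoherentIso : ∃ B : A → (Lp ℂ 2 T.νQ ≃ₗᵢ[ℂ] T.H2), T.IsCoherentIso B := by
  choose B hB using fun η => exists_linearIsometryEquiv_of_inner_eq (𝕜 := ℂ)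
    (e := T.coherentLp η) (e' := T.coherentH2At η) (T.eq_zero_of_inner_coherentLp_eq_zero η)
    (T.eq_zero_of_inner_coherentH2At_eq_zero η) fun ζ ζ' => by
      rw [T.inner_coherentLp_coherentLp, T.inner_coherentH2At_coherentH2At]
  refine ⟨B, fun η ζ => ⟨T.memLp_coherentS η ζ, ?_⟩⟩
  rw [← coherentLp, hB, T.waveH_coherentH2At]

namespace IsCoherentIso

variable {T} {B B' : A → (Lp ℂ 2 T.νQ ≃ₗᵢ[ℂ] T.H2)}

theorem waveH_eq (hB : T.IsCoherentIso B) (η : A) (f : Lp ℂ 2 T.νQ) :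
    T.waveH η (B η f) = T.waveS η f := by
  ext ζ
  obtain ⟨_, map_coherentLp⟩ := hB η ζ
  rw [← T.waveH_coherentH2At η ζ] at map_coherentLp
  rw [← T.inner_coherentH2At, ← T.waveH_injective η map_coherentLp, (B η).inner_map_map,
    ← T.inner_coherentLp, coherentLp]

theorem waveH_toLp (hB : T.IsCoherentIso B) (η : A) {ψ : T.QHat → ℂ} (hψ : MemLp ψ 2 T.νQ) :
    T.waveH η (B η (hψ.toLp ψ)) = T.waveS η ψ := by
  rw [hB.waveH_eq, T.waveS_congr η hψ.coeFn_toLp]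

theorem unique (hB : T.IsCoherentIso B) (hB' : T.IsCoherentIso B') : B = B' := by
  ext1 η
  ext1 f
  exact T.waveH_injective η ((hB.waveH_eq η f).trans (hB'.waveH_eq η f).symm)

theorem exists_change_base (hB : T.IsCoherentIso B) (η η' : A) (ψ : Lp ℂ 2 T.νQ) :
    ∃ ψ' : Lp ℂ 2 T.νQ,
      (ψ' =ᵐ[T.νQ] fun φ => ψ (φ + T.inclQ (T.q (η' -ᵥ η))) * T.coherentS η' η φ) ∧
        T.waveH η' (B η' ψ') = T.waveH η (B η ψ) := by
  have memLp := T.memLp_change_base η η' ψ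
  refine ⟨memLp.toLp _, memLp.coeFn_toLp, ?_⟩
  rw [hB.waveH_toLp, T.waveS_change_base, hB.waveH_eq]

theorem bijOn_HS_cpL2 (hB : T.IsCoherentIso B) (η : A) :
    Set.BijOn (fun f => T.waveH η (B η f)) (T.HS_cpL2 η) T.HHat_cp := by
  refine ⟨?_, ((T.waveH_injective η).comp (B η).injective).injOn, fun χ hχ => ?_⟩
  · rintro f ⟨ψ, hψ, hf⟩
    simp only [hB.waveH_eq, T.waveS_congr η hf]
    exact T.waveS_mem_HHat_cp hψ
  · obtain ⟨ψ, hψ, rfl⟩ := T.exists_waveS_eq_of_mem_HHat_cp η hχ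
    have memLp := T.memLp_of_mem_HS_cp hψ
    exact ⟨memLp.toLp ψ, ⟨ψ, hψ, memLp.coeFn_toLp⟩, hB.waveH_toLp η memLp⟩

theorem waveH_quantS (hB : T.IsCoherentIso B) (η : A) (F : A →ᴬ[ℝ] ℝ) {ψ : T.QHat → ℂ}
    (hψ : ψ ∈ T.HS_cp η) : ∃ (h : MemLp ψ 2 T.νQ) (hF : MemLp (T.quantS η F ψ) 2 T.νQ),
      T.waveH η (B η (hF.toLp (T.quantS η F ψ))) =
        T.quantH F (T.waveH η (B η (h.toLp ψ))) := by
  refine ⟨T.memLp_of_mem_HS_cp hψ, T.memLp_of_mem_HS_cp (T.quantS_mem_HS_cp F hψ), ?_⟩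
  rw [hB.waveH_toLp, hB.waveH_toLp, T.waveS_quantS η F (T.HS_cp_le_polyExp η hψ)]

end IsCoherentIso

theorem HHat_cp_subset_HHat : (T.HHat_cp : Set (A → ℂ)) ⊆ T.HHat := by
  obtain ⟨B, hB⟩ := T.exists_isCoherentIso
  intro χ hχ
  obtain ⟨η⟩ : Nonempty A := AddTorsor.nonempty (G := L)
  obtain ⟨ψ, hψ, rfl⟩ := T.exists_waveS_eq_of_mem_HHat_cp η hχ
  exact ⟨η, _, (hB.waveH_toLp η (T.memLp_of_mem_HS_cp hψ)).symm⟩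

end AffineFieldTheory

end

theorem mainTheorem12 {L A : Type*} [NormedAddCommGroup L] [InnerProductSpace ℝ L]
    [CompleteSpace L] [TopologicalSpace.SeparableSpace L] [MetricSpace A] [NormedAddTorsor L A]
    (T : AffineFieldTheory L A) :
    -- restriction to `L` is evaluation on holomorphic cylinder functions
    (∀ (p : T.LHat → ℂ) (f : T.H2), T.IsCylinderHolomorphic p →
      (f : Lp ℂ 2 T.νL) =ᵐ[T.νL] p → ∀ ξ : L, T.restrictL f ξ = p (T.inclL ξ)) ∧
    -- the Hilbert space of wave functions on `A` does not depend on the base point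
    (∀ η : A, Set.BijOn (T.waveH η) Set.univ T.HHat) ∧
    (∀ (η η' : A) (f f' : T.H2), T.waveH η f = T.waveH η' f' → ‖f‖ = ‖f'‖) ∧
    -- the isomorphism preserving coherent states exists and is unique
    (∃! B : A → (Lp ℂ 2 T.νQ ≃ₗᵢ[ℂ] T.H2), T.IsCoherentIso B) ∧
    ∀ B : A → (Lp ℂ 2 T.νQ ≃ₗᵢ[ℂ] T.H2), T.IsCoherentIso B →
      -- it does not depend on the base point
      (∀ (η η' : A) (ψ : Lp ℂ 2 T.νQ), ∃ ψ' : Lp ℂ 2 T.νQ,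
        (ψ' =ᵐ[T.νQ] fun φ => ψ (φ + T.inclQ (T.q (η' -ᵥ η))) * T.coherentS η' η φ) ∧
          T.waveH η' (B η' ψ') = T.waveH η (B η ψ)) ∧
      ∀ η : A,
        -- the generated subspaces consist of states on which the observables act
        (∀ ψ ∈ T.HS_cp η, MemLp ψ 2 T.νQ ∧
          ∀ (φ : T.QHat) (χ : T.Q), DifferentiableAt ℝ (fun t : ℝ => ψ (φ + t • T.inclQ χ)) 0) ∧
        (∀ ψ ∈ T.HHat_cp, ψ ∈ T.HHat ∧
          ∀ (ζ : A) (ξ : L), DifferentiableAt ℝ (fun t : ℝ => ψ (t • ξ +ᵥ ζ)) 0) ∧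
        (∀ (F : A →ᴬ[ℝ] ℝ), ∀ ψ ∈ T.HS_cp η, T.quantS η F ψ ∈ T.HS_cp η) ∧
        (∀ (F : A →ᴬ[ℝ] ℝ), ∀ ψ ∈ T.HHat_cp, T.quantH F ψ ∈ T.HHat_cp) ∧
        -- the isomorphism restricts to these subspaces
        Set.BijOn (fun f => T.waveH η (B η f)) (T.HS_cpL2 η) T.HHat_cp ∧
        -- and intertwines the quantized observables
        (∀ (F : A →ᴬ[ℝ] ℝ), ∀ ψ ∈ T.HS_cp η, ∃ (h : MemLp ψ 2 T.νQ)
          (hF : MemLp (T.quantS η F ψ) 2 T.νQ),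
          T.waveH η (B η (hF.toLp (T.quantS η F ψ))) =
            T.quantH F (T.waveH η (B η (h.toLp ψ)))) := by
  refine ⟨fun p f hp hf => T.restrictL_eq_of_cylinder hp hf, T.bijOn_waveH,
    fun _ _ _ _ => T.norm_eq_of_waveH_eq, ?_, fun B hB => ⟨hB.exists_change_base, fun η =>
      ⟨fun ψ hψ => ⟨T.memLp_of_mem_HS_cp hψ, fun φ χ =>
        T.lineDifferentiableAt_of_mem_HS_cp hψ φ (T.inclQ χ)⟩,
      fun χ hχ => ⟨T.HHat_cp_subset_HHat hχ, T.differentiableAt_of_mem_HHat_cp hχ⟩,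
      fun F _ => T.quantS_mem_HS_cp F, fun F _ => T.quantH_mem_HHat_cp F,
      hB.bijOn_HS_cpL2 η, fun F _ => hB.waveH_quantS η F⟩⟩⟩
  obtain ⟨B, hB⟩ := T.exists_isCoherentIso
  exact ⟨B, hB, fun B' hB' => hB'.unique hB⟩
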